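/- **Definitions.** For a finite graph $G=(V,E)$ and $X\subseteq V$, the boundary $\partial X$ is the set of vertices outside $X$ that have a neighbour in $X$, and $\mu_G(k)=\min\{|\partial X| : X\subseteq V,\ |X|=k\}$. A set $X$ of vertices is optimal if $|\partial X|=\mu_G(|X|)$. The Johnson graph $J(n,m)$ has the $m$-subsets of $[n]=\{1,\dots,n\}$ as vertices, two of them being adjacent when their symmetric difference has two elements; $\mu_{n,m}=\mu_{J(n,m)}$. The colex order on $m$-subsets of $[n]$ is given, for $X\ne Y$, by $X<Y$ if and only if $\max\big((X\setminus Y)\cup(Y\setminus X)\big)\in Y$; the initial segment of length $k$ consists of the first $k$ of the $m$-subsets of $[n]$ in this order. Every pair of positive integers $k,m$ has a unique $m$-binomial (cascade) representation $$k=\binom{k_0}{m}+\binom{k_1}{m-1}+\cdots+\binom{k_r}{m-r},\qquad k_0>k_1>\cdots>k_r\ge m-r>0,$$ and one puts $$f(k,n,m)=\binom{k_0}{m-1}(n-k_0)+\sum_{i=1}^{r}\left(\binom{k_i}{m-i-1}(n-k_0-1)-\binom{k_i}{m-i}\right),\qquad f(0,n,m)=0.$$ **Theorem.** Let $k,m$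 be positive integers with the $m$-binomial representation of $k$ written as above. There is a number $n(k,m)$ such that, for all $n\ge n(k,m)$, the following holds. (i) If $r<m-1$, then $\mu_{n,m}(k)=f(k,n,m)$, and the initial segment of length $k$ in the colex order is, up to automorphisms of $J(n,m)$, the only optimal set of cardinality $k$ in $J(n,m)$ (it is optimal, and every optimal set of cardinality $k$ is mapped onto it by an automorphism of $J(n,m)$). (ii) If $r=m-1$, then $\mu_{n,m}(k)\ge f(k-k_r,n,m)+k_r$. -/

import Mathlib

namespace JohnsonIso

section Graph

variable {V : Type*}

open Classical in
/-- The (outer vertex) boundary of `X`: the vertices outside `X` that have a neighbour in `X`. -/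
noncomputable def boundary [Fintype V] (G : SimpleGraph V) (X : Finset V) : Finset V :=
  {y : V | y ∉ X ∧ ∃ x ∈ X, G.Adj x y}

/-- The vertex-isoperimetric function of `G`: the smallest size of the boundary of a set of `k`
vertices. (If `G` has fewer than `k` vertices, this is the infimum of the empty set, `0`.) -/
noncomputable def isoFun [Fintype V] (G : SimpleGraph V) (k : ℕ) : ℕ :=
  sInf {b : ℕ | ∃ X : Finset V, X.card = k ∧ (boundary G X).card = b}

/-- A set of vertices is optimal if its boundary is smallest among all sets of its size. -/
def IsOptimal [Fintype V] (G : SimpleGraph V) (X : Finset V) : Prop :=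
  (boundary G X).card = isoFun G X.card

end Graph

/-- The `m`-subsets of an `n`-set. -/
abbrev Vertex (n m : ℕ) : Type := {s : Finset (Fin n) // s.card = m}

/-- The Johnson graph `J(n, m)`: two `m`-subsets of an `n`-set are adjacent when their symmetric
difference has two elements. -/
def johnsonGraph (n m : ℕ) : SimpleGraph (Vertex n m) where
  Adj s t := (symmDiff s.1 t.1).card = 2
  symm := ⟨fun s t h => by rwa [symmDiff_comm]⟩
  loopless := ⟨fun s h => by simp at h⟩

/-- `μ_{n,m}(k)`. -/
noncomputable def mu (n m k : ℕ) : ℕ := isoFun (johnsonGraph n m) k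

/-- The first `k` of the `m`-subsets of an `n`-set in the colex order (all of them if there are
fewer than `k`): the sets that are preceded by fewer than `k` others. -/
def colexInitSeg (n m k : ℕ) : Finset (Vertex n m) :=
  {s : Vertex n m | (Finset.univ.filter fun t : Vertex n m =>
    toColex t.1 < toColex s.1).card < k}

/-- `k = C(a 0, m) + C(a 1, m - 1) + ⋯ + C(a r, m - r)` is the `m`-binomial (cascade)
representation of `k`: here `a 0 > a 1 > ⋯ > a r ≥ m - r > 0`. The values of `a` beyond `r` play
no role. -/
structure IsBinomialRep (m k r : ℕ) (a : ℕ → ℕ) : Prop where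
  lt : r < m
  anti : ∀ i < r, a (i + 1) < a i
  le : m - r ≤ a r
  sum : k = ∑ i ∈ Finset.range (r + 1), (a i).choose (m - i)

/-- The value of `f(k, n, m)` computed from a binomial representation of `k`. -/
def fOfRep (n m r : ℕ) (a : ℕ → ℕ) : ℤ :=
  ((a 0).choose (m - 1) : ℤ) * ((n : ℤ) - a 0) +
    ∑ i ∈ Finset.Icc 1 r,
      (((a i).choose (m - i - 1) : ℤ) * ((n : ℤ) - a 0 - 1) - ((a i).choose (m - i) : ℤ))

open Classical in
/-- `f(k, n, m)`, computed from the binomial representation of `k` (see `f_eq`). For `k = 0`, which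
has the empty representation, it is `0`. -/
noncomputable def f (k n m : ℕ) : ℤ :=
  if h : ∃ p : ℕ × (ℕ → ℕ), IsBinomialRep m k p.1 p.2 then
    fOfRep n m h.choose.1 h.choose.2
  else 0

theorem IsBinomialRep.lt_choose {m k r : ℕ} {a : ℕ → ℕ} (h : IsBinomialRep m k r a) :
    k < (a 0 + 1).choose m := by
  induction r generalizing m k a with
  | zero =>
    obtain ⟨h1, -, h3, h4⟩ := h
    obtain ⟨m, rfl⟩ : ∃ m', m = m' + 1 := ⟨m - 1, by omega⟩
    simp only [zero_add, Finset.sum_range_one, Nat.sub_zero] at h3 h4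
    have := Nat.choose_pos (show m ≤ a 0 by omega)
    rw [h4, Nat.choose_succ_succ']
    omega
  | succ r ih =>
    obtain ⟨h1, h2, h3, h4⟩ := h
    obtain ⟨m, rfl⟩ : ∃ m', m = m' + 1 := ⟨m - 1, by omega⟩
    have h5 := ih (m := m) (a := fun i => a (i + 1))
      (k := ∑ i ∈ Finset.range (r + 1), (a (i + 1)).choose (m - i))
      ⟨by omega, fun i hi => h2 (i + 1) (by omega), by simpa using h3, rfl⟩
    have h6 : (a 1 + 1).choose m ≤ (a 0).choose m :=
      Nat.choose_le_choose m (h2 0 (by omega))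
    rw [Finset.sum_range_succ'] at h4
    simp only [Nat.add_sub_add_right, Nat.sub_zero, zero_add] at h4 h5
    rw [h4, Nat.choose_succ_succ']
    omega

/-- The binomial representation is unique. -/
theorem IsBinomialRep.unique {m k r s : ℕ} {a b : ℕ → ℕ} (ha : IsBinomialRep m k r a)
    (hb : IsBinomialRep m k s b) : r = s ∧ ∀ i ≤ r, a i = b i := by
  have key : ∀ {m k r s : ℕ} {a b : ℕ → ℕ}, IsBinomialRep m k r a → IsBinomialRep m k s b →
      a 0 ≤ b 0 := by
    intro m k r s a b ha hb
    by_contra! hlt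
    have h1 := hb.lt_choose
    have h2 := ha.sum
    rw [Finset.sum_range_succ'] at h2
    have h3 : (b 0 + 1).choose m ≤ (a 0).choose m := Nat.choose_le_choose m hlt
    simp only [Nat.sub_zero] at h2
    omega
  have pos : ∀ {m r : ℕ} {a : ℕ → ℕ}, r + 1 < m → m - (r + 1) ≤ a (r + 1) →
      0 < ∑ i ∈ Finset.range (r + 1), (a (i + 1)).choose (m - (i + 1)) := by
    intro m r a _ h
    rw [Finset.sum_range_succ]
    have := Nat.choose_pos h
    omega
  induction r generalizing m k s a b with
  | zero =>
    have h0 : a 0 = b 0 := le_antisymm (key ha hb) (key hb ha)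
    rcases s with _ | s
    · exact ⟨rfl, fun i hi => by rwa [Nat.le_zero.mp hi]⟩
    · have h1 := ha.sum
      have h2 := hb.sum
      rw [Finset.sum_range_succ'] at h2
      simp only [zero_add, Finset.sum_range_one, h0] at h1
      have := pos hb.lt hb.le
      omega
  | succ r ih =>
    have h0 : a 0 = b 0 := le_antisymm (key ha hb) (key hb ha)
    have h1 := ha.sum
    have h2 := hb.sum
    rcases s with _ | s
    · rw [Finset.sum_range_succ'] at h1
      simp only [zero_add, Finset.sum_range_one, ← h0] at h2
      have := pos ha.lt ha.le
      omega
    · rw [Finset.sum_range_succ'] at h1 h2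
      obtain ⟨m, rfl⟩ : ∃ m', m = m' + 1 := ⟨m - 1, by have := ha.lt; omega⟩
      simp only [Nat.add_sub_add_right, ← h0] at h1 h2
      obtain ⟨e, h3⟩ := ih (m := m) (s := s) (a := fun i => a (i + 1)) (b := fun i => b (i + 1))
        (k := ∑ i ∈ Finset.range (r + 1), (a (i + 1)).choose (m - i))
        ⟨by have := ha.lt; omega, fun i hi => ha.anti (i + 1) (by omega),
          by simpa using ha.le, rfl⟩
        ⟨by have := hb.lt; omega, fun i hi => hb.anti (i + 1) (by omega),
          by simpa using hb.le, by omega⟩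
      refine ⟨by omega, fun i hi => ?_⟩
      rcases i with _ | i
      · exact h0
      · exact h3 i (by omega)

/-- `f(k, n, m)` is given by the formula, whichever way the representation of `k` is written. -/
theorem f_eq {k n m r : ℕ} {a : ℕ → ℕ} (h : IsBinomialRep m k r a) :
    f k n m = fOfRep n m r a := by
  have hex : ∃ p : ℕ × (ℕ → ℕ), IsBinomialRep m k p.1 p.2 := ⟨(r, a), h⟩
  obtain ⟨e, h3⟩ := hex.choose_spec.unique h
  rw [f, dif_pos hex]
  unfold fOfRep
  rw [e] at h3 ⊢
  rw [h3 0 (Nat.zero_le r)]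
  congr 1
  refine Finset.sum_congr rfl fun i hi => ?_
  rw [h3 i (Finset.mem_Icc.mp hi).2]

/-- Every positive integer has an `m`-binomial representation, for each `m ≥ 1`. -/
theorem exists_isBinomialRep {m k : ℕ} (hm : 0 < m) (hk : 0 < k) :
    ∃ (r : ℕ) (a : ℕ → ℕ), IsBinomialRep m k r a := by
  induction m generalizing k with
  | zero => omega
  | succ m ih =>
    have big : ∀ j, j + 1 ≤ (j + m + 1).choose (m + 1) := by
      intro j
      induction j with
      | zero => simp
      | succ j ihj =>
        have e : j + 1 + m + 1 = (j + m + 1) + 1 := by ring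
        have := Nat.choose_pos (show m ≤ j + m + 1 by omega)
        rw [e, Nat.choose_succ_succ']
        omega
    obtain ⟨x, hx1, hx2, hx3⟩ : ∃ x, m + 1 ≤ x ∧ x.choose (m + 1) ≤ k ∧
        k < (x + 1).choose (m + 1) := by
      have hex : ∃ y, k < (y + 1).choose (m + 1) := ⟨k + m, big k⟩
      refine ⟨Nat.find hex, ?_, ?_, Nat.find_spec hex⟩
      · by_contra! hlt
        have h1 := Nat.find_spec hex
        have h2 := Nat.choose_le_choose (m + 1) (show Nat.find hex + 1 ≤ m + 1 by omega)
        rw [Nat.choose_self] at h2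
        omega
      · rcases hf : Nat.find hex with _ | y
        · simp
        · exact not_lt.mp (Nat.find_min hex (m := y) (by omega))
    rw [Nat.choose_succ_succ'] at hx3
    rcases Nat.eq_zero_or_pos (k - x.choose (m + 1)) with h0 | h0
    · exact ⟨0, fun _ => x, by omega, fun i hi => by omega, by simpa using hx1, by simp; omega⟩
    · have hm' : 0 < m := by
        by_contra! hm0
        obtain rfl : m = 0 := by omega
        simp only [Nat.choose_zero_right] at hx3
        omega
      obtain ⟨r, b, hb⟩ := ih hm' h0
      have hlt : b 0 < x := by
        by_contra! hle
        have h1 := hb.sum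
        have h2 := Nat.choose_le_choose m hle
        rw [Finset.sum_range_succ'] at h1
        simp only [Nat.sub_zero] at h1
        omega
      refine ⟨r + 1, fun i => Nat.casesOn i x b, by have := hb.lt; omega, ?_, ?_, ?_⟩
      · rintro (_ | i) hi
        · exact hlt
        · exact hb.anti i (by omega)
      · simpa using hb.le
      · rw [Finset.sum_range_succ']
        simp only [Nat.add_sub_add_right, Nat.sub_zero]
        change k = _ + x.choose (m + 1)
        have := hb.sum
        omega

end JohnsonIso

namespace JohnsonIso.Cascade

open Finset
open scoped FinsetFamily

/-! ### Cascades -/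

/-! Write `∂` and `∂⁺` for the lower and upper shadow. For a set `X` of `k` vertices, `∂⁺ ∂ X` is
the disjoint union of `X` and its boundary, so minimising the boundary means minimising `∂⁺ ∂ X`.
Two distinct sets of equal size have at most one common superset with one more element; hence `#(∂⁺
∂ X)` is `#(∂ X) * (n - m + 1)` up to an error bounded in terms of `k` and `m`. For large `n` the
size of `∂ X` decides (`card_boundary_lt`), and the problem becomes Kruskal–Katona.

If the cascade of `k` has fewer than `m` terms, the minimiser of the shadow is unique up to a
permutation of the points (`exists_perm_image_eq`). The optimal sets are then the copies of the
colex initial segment, whose boundary is counted directly (`card_boundary_colexInitSeg`). If the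
cascade is full, its last term adds just 1 to the least shadow: it has some size `s + 1` with `f (k
- a r) n m ≤ s * n`, and the spare `n` absorbs `a r` and all error terms
(`le_card_boundary_of_full`).

Uniqueness is first shown for shifted families (`Shifted.downClosed`). Splitting at the first point
`t` gives a link (the sets containing `t`, with `t` removed) and a deletion (the sets avoiding `t`);
Pascal's rule and Kruskal–Katona force their sizes. Induction applies to the link if the cascade is
short enough, and otherwise to the deletion, whose shadow is then the whole link. Both fail only
when the cascade ends in `2` at the last level before it is full; then a set can be removed together
with two sets of the shadow, and induction applies to the remainder.

A general family is reduced to a shifted one by shifts, which do not enlarge the shadow. They can be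
undone: if a shift yields the initial segment and the shadow had its size already, then the shift
did nothing or merely swapped two points (`eq_or_image_swap_eq`). -/

/-- The number `C(c₀, m) + C(c₁, m - 1) + ⋯` of a cascade `c₀, c₁, …`; the sum stops at the term
`C(cₘ, 0)`. -/
def cas : ℕ → List ℕ → ℕ
  | _, [] => 0
  | 0, _ :: _ => 1
  | m + 1, c :: l => c.choose (m + 1) + cas m l

/-- The number `C(c₀, m - 1) + C(c₁, m - 2) + ⋯` of a cascade, without a term for `C(·, -1)`. -/
def casShadow : ℕ → List ℕ → ℕ
  | 0, _ => 0
  | m + 1, l => cas m l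

/-- Strictly decreasing lists. -/
abbrev Dec (l : List ℕ) : Prop := l.Pairwise (· > ·)

/-- The list has at most `m` entries, and `cᵢ ≥ m - i`. -/
def Nondeg : ℕ → List ℕ → Prop
  | _, [] => True
  | 0, _ :: _ => False
  | m + 1, c :: l => m + 1 ≤ c ∧ Nondeg m l

@[simp] theorem cas_nil (m : ℕ) : cas m [] = 0 := by cases m <;> rfl
@[simp] theorem cas_zero_cons (c : ℕ) (l : List ℕ) : cas 0 (c :: l) = 1 := rfl
@[simp] theorem cas_succ_cons (m c : ℕ) (l : List ℕ) :
    cas (m + 1) (c :: l) = c.choose (m + 1) + cas m l := rfl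
@[simp] theorem casShadow_zero (l : List ℕ) : casShadow 0 l = 0 := rfl
@[simp] theorem casShadow_succ (m : ℕ) (l : List ℕ) : casShadow (m + 1) l = cas m l := rfl
@[simp] theorem nondeg_nil (m : ℕ) : Nondeg m [] := by cases m <;> trivial
@[simp] theorem nondeg_zero_cons (c : ℕ) (l : List ℕ) : ¬ Nondeg 0 (c :: l) := fun h => h
@[simp] theorem nondeg_succ_cons (m c : ℕ) (l : List ℕ) :
    Nondeg (m + 1) (c :: l) ↔ m + 1 ≤ c ∧ Nondeg m l := Iff.rfl

theorem choose_le_cas (m c : ℕ) (l : List ℕ) : c.choose m ≤ cas m (c :: l) := by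
  cases m <;> simp

/-- The tail starts below `c`, so it is at most `C(c, m - 1)`; Pascal's rule finishes. -/
theorem cas_cons_le {m c : ℕ} {l : List ℕ} (h : Dec (c :: l)) :
    cas m (c :: l) ≤ (c + 1).choose m := by
  induction l generalizing m c with
  | nil => cases m <;> simp [Nat.choose_succ_succ']
  | cons d l ih =>
    rcases m with _ | m
    · simp
    · have h1 := ih (m := m) (List.Pairwise.of_cons h)
      have h2 : d < c := by simpa using (List.pairwise_cons.mp h).1 d (by simp)
      have h3 := Nat.choose_le_choose m (show d + 1 ≤ c by omega)
      rw [cas_succ_cons, Nat.choose_succ_succ']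
      omega

/-- The cascade numbers at two consecutive levels are ordered in the same way. -/
theorem cas_le_of_cas_succ_lt {m : ℕ} {l l' : List ℕ} (h : Dec l) (h' : Dec l')
    (hlt : cas (m + 1) l < cas (m + 1) l') : cas m l ≤ cas m l' := by
  induction l generalizing m l' with
  | nil => simp
  | cons c l ih =>
    rcases l' with _ | ⟨d, l'⟩
    · simp at hlt
    rcases lt_trichotomy c d with hcd | rfl | hcd
    · exact (cas_cons_le h).trans ((Nat.choose_le_choose m hcd).trans (choose_le_cas m d l'))
    · rcases m with _ | m
      · simp
      · simp only [cas_succ_cons] at hlt ⊢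
        have := ih h.of_cons h'.of_cons (m := m) (by omega)
        omega
    · have h1 := cas_cons_le (m := m + 1) h'
      have h2 := Nat.choose_le_choose (m + 1) (show d + 1 ≤ c by omega)
      have h3 := choose_le_cas (m + 1) c l
      omega

theorem casShadow_le_of_cas_lt {m : ℕ} {l l' : List ℕ} (h : Dec l) (h' : Dec l')
    (hlt : cas m l < cas m l') : casShadow m l ≤ casShadow m l' := by
  cases m
  · simp
  · exact cas_le_of_cas_succ_lt h h' hlt

/-- The list with all entries lowered by one. -/
abbrev low (l : List ℕ) : List ℕ := l.map (· - 1)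

/-- Pascal's rule, term by term. It mirrors the splitting of a family into deletion and link of its
first point. -/
theorem cas_eq_add_low {m : ℕ} {l : List ℕ} (h : ∀ c ∈ l, 1 ≤ c) :
    cas m l = cas m (low l) + casShadow m (low l) := by
  induction l generalizing m with
  | nil => cases m <;> simp [low]
  | cons c l ih =>
    obtain ⟨c, rfl⟩ : ∃ c', c = c' + 1 := ⟨c - 1, by have := h c (by simp); omega⟩
    rcases m with _ | m
    · simp
    · have h1 := ih (m := m) fun x hx => h x (by simp [hx])
      simp only [low, List.map_cons, cas_succ_cons, casShadow_succ, Nat.add_sub_cancel] at h1 ⊢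
      rw [h1]
      rcases m with _ | m
      · simp; omega
      · simp only [casShadow_succ, cas_succ_cons, Nat.choose_succ_succ' c (m + 1)]
        omega

theorem Dec.low {l : List ℕ} (h : Dec l) (h1 : ∀ c ∈ l, 1 ≤ c) : Dec (low l) := by
  rw [Dec, List.pairwise_map]
  refine h.imp_of_mem fun {a b} ha hb hab => ?_
  have := h1 b hb
  simp only [gt_iff_lt] at hab ⊢
  omega

theorem Nondeg.one_le {m : ℕ} {l : List ℕ} (h : Nondeg m l) : ∀ c ∈ l, 1 ≤ c := by
  induction l generalizing m with
  | nil => simp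
  | cons c l ih =>
    rcases m with _ | m
    · simp at h
    · rw [nondeg_succ_cons] at h
      intro d hd
      rcases List.mem_cons.mp hd with rfl | hd
      · omega
      · exact ih h.2 d hd

theorem Nondeg.low {m : ℕ} {l : List ℕ} (h : Nondeg (m + 1) l) (hl : l.length ≤ m) :
    Nondeg m (low l) := by
  induction l generalizing m with
  | nil => simp
  | cons c l ih =>
    rcases m with _ | m
    · simp at hl
    · rw [nondeg_succ_cons] at h
      simp only [List.length_cons, Nat.add_le_add_iff_right] at hl
      simp only [List.map_cons, nondeg_succ_cons]
      exact ⟨by omega, ih h.2 hl⟩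

theorem Nondeg.of_append {m : ℕ} {l l' : List ℕ} (h : Nondeg m (l ++ l')) : Nondeg m l := by
  induction l generalizing m with
  | nil => simp
  | cons c l ih =>
    rcases m with _ | m
    · simp at h
    · simp only [List.cons_append, nondeg_succ_cons] at h ⊢
      exact ⟨h.1, ih h.2⟩

theorem cas_append_singleton (m : ℕ) (l : List ℕ) (c : ℕ) (h : l.length ≤ m) :
    cas m (l ++ [c]) = cas m l + c.choose (m - l.length) := by
  induction l generalizing m with
  | nil => cases m <;> simp
  | cons d l ih =>
    rcases m with _ | m
    · simp at h
    · simp only [List.length_cons, Nat.add_le_add_iff_right] at h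
      simp [ih m h, add_assoc]

theorem cas_append_of_lt (m : ℕ) (l l' : List ℕ) (h : m < l.length) :
    cas m (l ++ l') = cas m l := by
  induction l generalizing m with
  | nil => simp at h
  | cons d l ih =>
    rcases m with _ | m
    · simp
    · simp only [List.length_cons, Nat.add_lt_add_iff_right] at h
      simp [ih m h]

/-! ### The colex order on finite sets of natural numbers -/

/-- `s` precedes `t` in the colex order. -/
def ColexLT (s t : Finset ℕ) : Prop := ∃ k, k ∈ t ∧ k ∉ s ∧ ∀ a, k < a → (a ∈ s ↔ a ∈ t)

theorem toColex_lt_iff {α : Type*} [LinearOrder α] {s t : Finset α} :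
    toColex s < toColex t ↔ ∃ k, k ∈ t ∧ k ∉ s ∧ ∀ a, k < a → (a ∈ s ↔ a ∈ t) := by
  simp only [Finset.Colex.lt_iff_exists_filter_lt, mem_sdiff, filter_inj, and_assoc]

theorem colexLT_iff {s t : Finset ℕ} : ColexLT s t ↔ toColex s < toColex t :=
  toColex_lt_iff.symm

theorem colexLT_trichotomy (s t : Finset ℕ) : ColexLT s t ∨ s = t ∨ ColexLT t s := by
  rw [colexLT_iff, colexLT_iff]
  simpa using lt_trichotomy (toColex s) (toColex t)

/-- The initial segment of the colex order on `m`-sets with a given cascade. -/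
def casc : ℕ → List ℕ → Finset (Finset ℕ)
  | _, [] => ∅
  | 0, _ :: _ => {∅}
  | m + 1, c :: l => powersetCard (m + 1) (range c) ∪ (casc m l).image (insert c)

@[simp] theorem casc_nil (m : ℕ) : casc m [] = ∅ := by cases m <;> rfl
@[simp] theorem casc_zero_cons (c : ℕ) (l : List ℕ) : casc 0 (c :: l) = {∅} := rfl
theorem casc_succ_cons (m c : ℕ) (l : List ℕ) : casc (m + 1) (c :: l) =
    powersetCard (m + 1) (range c) ∪ (casc m l).image (insert c) := rfl

theorem mem_casc_succ_cons {m c : ℕ} {l : List ℕ} {x : Finset ℕ} : x ∈ casc (m + 1) (c :: l) ↔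
    ((∀ e ∈ x, e < c) ∧ #x = m + 1) ∨ ∃ y ∈ casc m l, insert c y = x := by
  simp [casc_succ_cons, mem_powersetCard, subset_iff]

theorem lt_of_mem_casc {m b : ℕ} {l : List ℕ} (h : Dec l) (hb : ∀ c ∈ l, c < b) {x : Finset ℕ}
    (hx : x ∈ casc m l) : ∀ e ∈ x, e < b := by
  induction l generalizing m x with
  | nil => simp at hx
  | cons c l ih =>
    rcases m with _ | m
    · simp_all
    · rw [mem_casc_succ_cons] at hx
      have hc := hb c (by simp)
      obtain ⟨hx, -⟩ | ⟨y, hy, rfl⟩ := hx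
      · exact fun e he => (hx e he).trans hc
      · intro e he
        obtain rfl | he := mem_insert.mp he
        · exact hc
        · exact ih h.of_cons (fun d hd => hb d (by simp [hd])) hy e he

theorem lt_of_mem_casc_tail {m c : ℕ} {l : List ℕ} (h : Dec (c :: l)) {x : Finset ℕ}
    (hx : x ∈ casc m l) : ∀ e ∈ x, e < c :=
  lt_of_mem_casc h.of_cons (fun d hd => by simpa using (List.pairwise_cons.mp h).1 d hd) hx

theorem notMem_of_mem_casc_tail {m c : ℕ} {l : List ℕ} (h : Dec (c :: l)) {x : Finset ℕ}
    (hx : x ∈ casc m l) : c ∉ x :=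
  fun hc => (lt_of_mem_casc_tail h hx c hc).false

theorem card_of_mem_casc {m : ℕ} {l : List ℕ} (h : Dec l) {x : Finset ℕ} (hx : x ∈ casc m l) :
    #x = m := by
  induction l generalizing m x with
  | nil => simp at hx
  | cons c l ih =>
    rcases m with _ | m
    · simp_all
    · obtain ⟨-, hx⟩ | ⟨y, hy, rfl⟩ := mem_casc_succ_cons.mp hx
      · exact hx
      · rw [card_insert_of_notMem (notMem_of_mem_casc_tail h hy), ih h.of_cons hy]

theorem card_casc {m : ℕ} {l : List ℕ} (h : Dec l) : #(casc m l) = cas m l := by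
  induction l generalizing m with
  | nil => simp
  | cons c l ih =>
    rcases m with _ | m
    · simp
    · rw [casc_succ_cons, card_union_of_disjoint, card_powersetCard, card_range, card_image_of_injOn,
        ih h.of_cons, cas_succ_cons]
      · intro x hx y hy hxy
        simpa [erase_insert (notMem_of_mem_casc_tail h hx),
          erase_insert (notMem_of_mem_casc_tail h hy)] using congrArg (fun s => s.erase c) hxy
      · rw [disjoint_left]
        intro x hx hx'
        obtain ⟨y, -, rfl⟩ := mem_image.mp hx'
        simpa using (mem_powersetCard.mp hx).1 (mem_insert_self c y)

/-- `F` is closed downwards in the colex order on sets of the same size with elements `≥ t`. -/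
def DownClosed (t : ℕ) (F : Finset (Finset ℕ)) : Prop :=
  ∀ x ∈ F, ∀ y : Finset ℕ, #y = #x → (∀ e ∈ y, t ≤ e) → ColexLT y x → y ∈ F

theorem downClosed_casc {m : ℕ} {l : List ℕ} (h : Dec l) : DownClosed 0 (casc m l) := by
  induction l generalizing m with
  | nil => simp [DownClosed]
  | cons c l ih =>
    rintro x hx y hy - ⟨k, hk⟩
    rw [card_of_mem_casc h hx] at hy
    rcases m with _ | m
    · simp_all
    rw [mem_casc_succ_cons] at hx ⊢
    obtain ⟨hx, -⟩ | ⟨x, hx, rfl⟩ := hx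
    · refine Or.inl ⟨fun e he => ?_, hy⟩
      by_contra! hec
      have := hx k hk.1
      exact absurd (hx e ((hk.2.2 e (by omega)).mp he)) (by omega)
    · have hxc := lt_of_mem_casc_tail h hx
      obtain hkc | rfl := mem_insert.mp hk.1 |>.symm.imp_right id
      · have hkc' := hxc k hkc
        have hcy : c ∈ y := (hk.2.2 c hkc').mpr (mem_insert_self c x)
        refine Or.inr ⟨y.erase c, ih h.of_cons x hx _ ?_ (by simp) ⟨k, hkc, ?_, fun a ha => ?_⟩,
          insert_erase hcy⟩
        · rw [card_erase_of_mem hcy, hy, card_of_mem_casc h.of_cons hx, Nat.add_sub_cancel]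
        · simp [hk.2.1]
        · have h1 := hk.2.2 a ha
          have h2 := hxc a
          rw [mem_erase, h1, mem_insert]
          constructor
          · rintro ⟨h3, h4⟩; tauto
          · intro h3; exact ⟨(h2 h3).ne, Or.inr h3⟩
      · refine Or.inl ⟨fun e he => ?_, hy⟩
        by_contra! hec
        have hek : k < e := lt_of_le_of_ne hec (by rintro rfl; exact hk.2.1 he)
        obtain rfl | h3 := mem_insert.mp ((hk.2.2 e hek).mp he)
        · omega
        · exact absurd (hxc e h3) (by omega)

/-- Deleting `c` from `insert c y` leaves a subset of `range c`, which is present anyway; deleting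
another element is the recursion. Nondegeneracy leaves room to extend every `m`-subset of `range c`.
-/
theorem shadow_casc {m : ℕ} {l : List ℕ} (h : Dec l) (hl : Nondeg (m + 1) l) :
    ∂ (casc (m + 1) l) = casc m l := by
  induction l generalizing m with
  | nil => simp
  | cons c l ih =>
    rw [nondeg_succ_cons] at hl
    ext y
    rw [mem_shadow_iff_insert_mem]
    rcases m with _ | m
    · simp only [casc_zero_cons, mem_singleton]
      constructor
      · rintro ⟨a, ha, hx⟩
        have := card_of_mem_casc h hx
        rw [card_insert_of_notMem ha] at this
        simpa using this
      · rintro rfl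
        exact ⟨0, by simp, mem_casc_succ_cons.mpr (Or.inl ⟨by simp; omega, by simp⟩)⟩
    · constructor
      · rintro ⟨a, ha, hx⟩
        have hy := card_of_mem_casc h hx
        rw [card_insert_of_notMem ha] at hy
        rw [mem_casc_succ_cons] at hx ⊢
        obtain ⟨hx, -⟩ | ⟨x, hx, hxy⟩ := hx
        · exact Or.inl ⟨fun e he => hx e (by simp [he]), by omega⟩
        · have hcx := notMem_of_mem_casc_tail h hx
          by_cases hac : a = c
          · subst hac
            have : x = y := by
              simpa [erase_insert ha, erase_insert hcx] using congrArg (fun s => s.erase a) hxy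
            subst this
            exact Or.inl ⟨lt_of_mem_casc_tail h hx, by omega⟩
          · have hcy : c ∈ y := by
              have : c ∈ insert a y := hxy ▸ mem_insert_self c x
              simpa [Ne.symm hac] using this
            refine Or.inr ⟨y.erase c, ?_, insert_erase hcy⟩
            rw [← ih h.of_cons hl.2, mem_shadow_iff_insert_mem]
            refine ⟨a, by simp [ha], ?_⟩
            convert hx using 1
            rw [← erase_insert_of_ne hac, ← hxy, erase_insert hcx]
      · intro hy
        rw [mem_casc_succ_cons] at hy
        obtain ⟨hy, hy'⟩ | ⟨x, hx, rfl⟩ := hy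
        · obtain ⟨a, ha, hay⟩ := exists_mem_notMem_of_card_lt_card (s := y) (t := range c)
            (by rw [card_range]; omega)
          refine ⟨a, hay, mem_casc_succ_cons.mpr (Or.inl ⟨?_, ?_⟩)⟩
          · intro e he
            obtain rfl | he := mem_insert.mp he
            · simpa using ha
            · exact hy e he
          · rw [card_insert_of_notMem hay, hy']
        · rw [← ih h.of_cons hl.2, mem_shadow_iff_insert_mem] at hx
          obtain ⟨a, ha, hx⟩ := hx
          have hac : a ≠ c := (lt_of_mem_casc_tail h hx a (mem_insert_self a x)).ne
          exact ⟨a, by simp [ha, hac], mem_casc_succ_cons.mpr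
            (Or.inr ⟨insert a x, hx, Finset.insert_comm _ _ _⟩)⟩

theorem card_shadow_casc {m : ℕ} {l : List ℕ} (h : Dec l) (hl : Nondeg m l) :
    #(∂ (casc m l)) = casShadow m l := by
  rcases m with _ | m
  · rcases l with _ | ⟨c, l⟩
    · simp
    · simp at hl
  · rw [shadow_casc h hl, card_casc h, casShadow_succ]

/-! ### The Kruskal–Katona theorem for finite sets of natural numbers -/

theorem shadow_image_map {α β : Type*} [DecidableEq α] [DecidableEq β] (g : α ↪ β)
    (F : Finset (Finset α)) : ∂ (F.image (map g)) = (∂ F).image (map g) := by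
  ext y
  simp only [mem_shadow_iff, mem_image]
  constructor
  · rintro ⟨_, ⟨x, hx, rfl⟩, b, hb, rfl⟩
    obtain ⟨a, ha, rfl⟩ := mem_map.mp hb
    exact ⟨x.erase a, ⟨x, hx, a, ha, rfl⟩, map_erase g x a⟩
  · rintro ⟨_, ⟨x, hx, a, ha, rfl⟩, rfl⟩
    exact ⟨x.map g, ⟨x, hx, rfl⟩, g a, mem_map_of_mem g ha, (map_erase g x a).symm⟩

theorem card_image_map {α β : Type*} [DecidableEq α] [DecidableEq β] (g : α ↪ β)
    (F : Finset (Finset α)) : #(F.image (map g)) = #F :=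
  card_image_of_injective F (map_injective g)

/-- The elements of `x` that are less than `n`, as elements of `Fin n`. -/
def finPart (n : ℕ) (x : Finset ℕ) : Finset (Fin n) := univ.filter fun i : Fin n => (i : ℕ) ∈ x

@[simp] theorem mem_finPart {n : ℕ} {x : Finset ℕ} {i : Fin n} :
    i ∈ finPart n x ↔ (i : ℕ) ∈ x := by simp [finPart]

@[simp] theorem finPart_map {n : ℕ} (x : Finset (Fin n)) :
    finPart n (x.map Fin.valEmbedding) = x := by
  ext e
  simp [Fin.val_inj]

theorem map_finPart {n : ℕ} {x : Finset ℕ} (h : ∀ e ∈ x, e < n) :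
    (finPart n x).map Fin.valEmbedding = x := by
  ext e
  simp only [mem_map, mem_finPart, Fin.valEmbedding_apply]
  exact ⟨by rintro ⟨i, hi, rfl⟩; exact hi, fun he => ⟨⟨e, h e he⟩, he, rfl⟩⟩

theorem card_finPart {n : ℕ} {x : Finset ℕ} (h : ∀ e ∈ x, e < n) : #(finPart n x) = #x := by
  rw [← card_map Fin.valEmbedding, map_finPart h]

theorem image_map_image_fin {F : Finset (Finset ℕ)} {n : ℕ} (h : ∀ x ∈ F, ∀ e ∈ x, e < n) :
    (F.image (finPart n)).image (map Fin.valEmbedding) = F := by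
  rw [image_image]
  exact (image_congr fun x hx => map_finPart (h x hx)).trans image_id

/-- Both families live on some `Fin n`, where `kruskal_katona` applies. -/
theorem card_shadow_le_of_downClosed {F C : Finset (Finset ℕ)} {m : ℕ} (hF : ∀ x ∈ F, #x = m)
    (hC : ∀ x ∈ C, #x = m) (hdown : DownClosed 0 C) (hcard : #C ≤ #F) : #(∂ C) ≤ #(∂ F) := by
  obtain ⟨n, hn⟩ : ∃ n, ∀ x ∈ F ∪ C, ∀ e ∈ x, e < n := by
    refine ⟨((F ∪ C).biUnion id).sup id + 1, fun x hx e he => ?_⟩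
    exact Nat.lt_succ_of_le (le_sup (f := id) (mem_biUnion.mpr ⟨x, hx, he⟩))
  have hnF := image_map_image_fin fun x hx => hn x (mem_union_left _ hx)
  have hnC := image_map_image_fin fun x hx => hn x (mem_union_right _ hx)
  have key := kruskal_katona (𝒜 := F.image (finPart n)) (𝒞 := C.image (finPart n)) (r := m)
    ?_ ?_ ?_
  · rwa [← card_image_map Fin.valEmbedding, ← card_image_map Fin.valEmbedding (∂ (F.image _)),
      ← shadow_image_map, ← shadow_image_map, hnF, hnC] at key
  · intro s hs
    obtain ⟨x, hx, rfl⟩ := mem_image.mp (mem_coe.mp hs)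
    rw [card_finPart (hn x (mem_union_left _ hx)), hF x hx]
  · rwa [← card_image_map Fin.valEmbedding, ← card_image_map Fin.valEmbedding (F.image _), hnF, hnC]
  · refine ⟨?_, ?_⟩
    · intro s hs
      obtain ⟨x, hx, rfl⟩ := mem_image.mp (mem_coe.mp hs)
      rw [card_finPart (hn x (mem_union_right _ hx)), hC x hx]
    · rintro s t hs ⟨hlt, ht⟩
      obtain ⟨x, hx, rfl⟩ := mem_image.mp hs
      refine mem_image.mpr ⟨t.map Fin.valEmbedding, hdown x hx _ (by rw [card_map, ht, hC x hx])
        (by simp) ?_, ?_⟩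
      · rw [colexLT_iff]
        have h1 : x = (finPart n x).image Fin.val := by
          conv_lhs => rw [← map_finPart (hn x (mem_union_right _ hx)), map_eq_image]
          rfl
        have h2 : t.map Fin.valEmbedding = t.image Fin.val := by
          rw [map_eq_image]; rfl
        rw [h1, h2]
        exact (Finset.Colex.toColex_image_lt_toColex_image Fin.val_strictMono).mpr hlt
      · exact finPart_map t

theorem casShadow_le_card_shadow {F : Finset (Finset ℕ)} {m : ℕ} {l : List ℕ}
    (hF : ∀ x ∈ F, #x = m) (h : Dec l) (hl : Nondeg m l) (hcard : cas m l ≤ #F) :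
    casShadow m l ≤ #(∂ F) := by
  rw [← card_shadow_casc h hl]
  exact card_shadow_le_of_downClosed hF (fun x hx => card_of_mem_casc h hx) (downClosed_casc h)
    (by rwa [card_casc h])

/-! ### Binomial representations as lists -/

/-- The list of the first `r + 1` values of a function. -/
def repList : ℕ → (ℕ → ℕ) → List ℕ
  | 0, a => [a 0]
  | r + 1, a => a 0 :: repList r fun i => a (i + 1)

theorem length_repList (r : ℕ) (a : ℕ → ℕ) : (repList r a).length = r + 1 := by
  induction r generalizing a with
  | zero => rfl
  | succ r ih => simp [repList, ih]

theorem mem_repList {r : ℕ} {a : ℕ → ℕ} {c : ℕ} : c ∈ repList r a ↔ ∃ i ≤ r, a i = c := by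
  induction r generalizing a with
  | zero => simp [repList, eq_comm]
  | succ r ih =>
    rw [repList, List.mem_cons, ih]
    constructor
    · rintro (rfl | ⟨i, hi, rfl⟩)
      · exact ⟨0, by omega, rfl⟩
      · exact ⟨i + 1, by omega, rfl⟩
    · rintro ⟨_ | i, hi, rfl⟩
      · exact Or.inl rfl
      · exact Or.inr ⟨i, by omega, rfl⟩

theorem cas_repList {m r : ℕ} (a : ℕ → ℕ) (h : r ≤ m) :
    cas m (repList r a) = ∑ i ∈ Finset.range (r + 1), (a i).choose (m - i) := by
  induction r generalizing m a with
  | zero => cases m <;> simp [repList]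
  | succ r ih =>
    obtain ⟨m, rfl⟩ : ∃ m', m = m' + 1 := ⟨m - 1, by omega⟩
    rw [repList, cas_succ_cons, ih _ (by omega), Finset.sum_range_succ' _ (r + 1)]
    simp [add_comm]

theorem dec_repList {r : ℕ} {a : ℕ → ℕ} (h : ∀ i < r, a (i + 1) < a i) : Dec (repList r a) := by
  induction r generalizing a with
  | zero => simp [repList]
  | succ r ih =>
    rw [repList, Dec, List.pairwise_cons]
    refine ⟨fun c hc => ?_, ih fun i hi => h (i + 1) (by omega)⟩
    obtain ⟨i, hi, rfl⟩ := mem_repList.mp hc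
    clear hc
    induction i with
    | zero => exact h 0 (by omega)
    | succ i ih' => exact (h (i + 1) (by omega)).trans (ih' (by omega))

theorem nondeg_repList {m r : ℕ} {a : ℕ → ℕ} (h : ∀ i < r, a (i + 1) < a i) (hr : r < m)
    (hle : m - r ≤ a r) : Nondeg m (repList r a) := by
  induction r generalizing m a with
  | zero =>
    obtain ⟨m, rfl⟩ : ∃ m', m = m' + 1 := ⟨m - 1, by omega⟩
    simpa [repList] using hle
  | succ r ih =>
    obtain ⟨m, rfl⟩ : ∃ m', m = m' + 1 := ⟨m - 1, by omega⟩
    rw [repList, nondeg_succ_cons]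
    have h1 := ih (m := m) (a := fun i => a (i + 1)) (fun i hi => h (i + 1) (by omega)) (by omega)
      (by simpa using hle)
    refine ⟨?_, h1⟩
    have h2 : a 1 < a 0 := h 0 (by omega)
    obtain ⟨m, rfl⟩ : ∃ m', m = m' + 1 := ⟨m - 1, by omega⟩
    cases r with
    | zero => simp [repList] at h1; omega
    | succ r => rw [repList, nondeg_succ_cons] at h1; simp at h1; omega

theorem exists_cascade {m k : ℕ} (hm : 0 < m) :
    ∃ l, Dec l ∧ Nondeg m l ∧ cas m l = k := by
  rcases Nat.eq_zero_or_pos k with rfl | hk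
  · exact ⟨[], by simp, by simp, by simp⟩
  · obtain ⟨r, a, h⟩ := exists_isBinomialRep hm hk
    exact ⟨repList r a, dec_repList h.anti, nondeg_repList h.anti h.lt h.le, by
      rw [cas_repList a h.lt.le, ← h.sum]⟩

/-- A form of the Kruskal–Katona theorem in which the cascade may be degenerate. -/
theorem casShadow_le_card_shadow_of_lt {F : Finset (Finset ℕ)} {m : ℕ} {l : List ℕ}
    (hF : ∀ x ∈ F, #x = m) (h : Dec l) (hcard : cas m l < #F) : casShadow m l ≤ #(∂ F) := by
  rcases Nat.eq_zero_or_pos m with rfl | hm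
  · simp
  -- Strict inequality matters: a degenerate last entry may raise the shadow number while leaving
  -- the size number unchanged.
  · obtain ⟨l', h1, h2, h3⟩ := exists_cascade (k := #F) hm
    exact (casShadow_le_of_cas_lt h h1 (by omega)).trans
      (casShadow_le_card_shadow hF h1 h2 h3.le)

theorem Nondeg.dec_append {m : ℕ} {l : List ℕ} (h : Dec l) (hl : Nondeg m l) :
    Dec (l ++ [m - l.length - 1]) := by
  rw [Dec, List.pairwise_append]
  refine ⟨h, by simp, fun c hc d hd => ?_⟩
  simp only [List.mem_singleton] at hd
  subst hd
  induction l generalizing m with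
  | nil => simp at hc
  | cons b l ih =>
    rcases m with _ | m
    · simp at hl
    rw [nondeg_succ_cons] at hl
    rcases List.mem_cons.mp hc with rfl | hc
    · simp only [List.length_cons, gt_iff_lt]; omega
    · have := ih h.of_cons hl.2 hc
      simpa using this

/-- If the cascade is not full, then the size of the shadow jumps after it. -/
theorem casShadow_lt_card_shadow {F : Finset (Finset ℕ)} {m : ℕ} {l : List ℕ}
    (hF : ∀ x ∈ F, #x = m) (h : Dec l) (hl : Nondeg m l) (hlen : l.length < m)
    (hcard : cas m l < #F) : casShadow m l < #(∂ F) := by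
  -- With `d = m - l.length - 1`, the extra entry contributes `C(d, d + 1) = 0` to the size and
  -- `C(d, d) = 1` to the shadow.
  have h1 := casShadow_le_card_shadow_of_lt (l := l ++ [m - l.length - 1]) hF (hl.dec_append h) (by
    rw [cas_append_singleton _ _ _ hlen.le, Nat.choose_eq_zero_of_lt (by omega)]
    exact hcard)
  obtain ⟨m, rfl⟩ : ∃ m', m = m' + 1 := ⟨m - 1, by omega⟩
  rw [casShadow_succ, cas_append_singleton _ _ _ (by omega),
    show m + 1 - l.length - 1 = m - l.length by omega, Nat.choose_self] at h1
  exact h1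

end JohnsonIso.Cascade

namespace JohnsonIso.Cascade

open Finset
open scoped FinsetFamily

/-! ### Shifted families -/

/-- The sets of `X` have elements `≥ t`, and `X` is closed under replacing an element of a set by a
smaller one. -/
structure Shifted (t : ℕ) (X : Finset (Finset ℕ)) : Prop where
  ge : ∀ x ∈ X, ∀ e ∈ x, t ≤ e
  shift : ∀ x ∈ X, ∀ i j, t ≤ i → i < j → j ∈ x → i ∉ x → insert i (x.erase j) ∈ X

variable {m t : ℕ} {l : List ℕ} {X : Finset (Finset ℕ)}

theorem Shifted.memberSubfamily (h : Shifted t X) : Shifted (t + 1) (X.memberSubfamily t) where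
  ge x hx e he := by
    rw [mem_memberSubfamily] at hx
    have h1 := h.ge _ hx.1 e (by simp [he])
    have h2 : e ≠ t := by rintro rfl; exact hx.2 he
    omega
  shift x hx i j hi hij hj hix := by
    rw [mem_memberSubfamily] at hx ⊢
    have h1 := h.shift _ hx.1 i j (by omega) hij (by simp [hj]) (by simp [hix]; omega)
    refine ⟨?_, by simp [hx.2]; omega⟩
    convert h1 using 1
    rw [erase_insert_of_ne (by omega), Finset.insert_comm]

theorem Shifted.nonMemberSubfamily (h : Shifted t X) :
    Shifted (t + 1) (X.nonMemberSubfamily t) where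
  ge x hx e he := by
    rw [mem_nonMemberSubfamily] at hx
    have h1 := h.ge _ hx.1 e he
    have h2 : e ≠ t := by rintro rfl; exact hx.2 he
    omega
  shift x hx i j hi hij hj hix := by
    rw [mem_nonMemberSubfamily] at hx ⊢
    exact ⟨h.shift _ hx.1 i j (by omega) hij hj hix, by simp [hx.2]; omega⟩

theorem card_of_mem_memberSubfamily (hX : ∀ x ∈ X, #x = m + 1) :
    ∀ x ∈ X.memberSubfamily t, #x = m := by
  intro x hx
  rw [mem_memberSubfamily] at hx
  have := hX _ hx.1
  rw [card_insert_of_notMem hx.2] at this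
  omega

theorem card_of_mem_nonMemberSubfamily (hX : ∀ x ∈ X, #x = m) :
    ∀ x ∈ X.nonMemberSubfamily t, #x = m :=
  fun x hx => hX x (mem_nonMemberSubfamily.mp hx).1

theorem card_of_mem_shadow (hX : ∀ x ∈ X, #x = m + 1) : ∀ x ∈ ∂ X, #x = m := by
  intro x hx
  obtain ⟨a, ha, hx⟩ := mem_shadow_iff_insert_mem.mp hx
  have := hX _ hx
  rw [card_insert_of_notMem ha] at this
  omega

theorem memberSubfamily_subset_shadow : X.memberSubfamily t ⊆ ∂ X := by
  intro x hx
  rw [mem_memberSubfamily] at hx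
  exact mem_shadow_iff_insert_mem.mpr ⟨t, hx.2, hx.1⟩

theorem memberSubfamily_shadow : (∂ X).memberSubfamily t = ∂ (X.memberSubfamily t) := by
  ext x
  simp only [mem_memberSubfamily, mem_shadow_iff_insert_mem, mem_insert, not_or]
  constructor
  · rintro ⟨⟨a, ⟨hat, hax⟩, h⟩, hx⟩
    exact ⟨a, hax, by rwa [Finset.insert_comm], Ne.symm hat, hx⟩
  · rintro ⟨a, hax, h, hta, hx⟩
    exact ⟨⟨a, ⟨Ne.symm hta, hax⟩, by rwa [Finset.insert_comm]⟩, hx⟩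

/-- In a set that avoids `t`, every element exceeds `t` and may be replaced by it. -/
theorem Shifted.shadow_nonMemberSubfamily_subset (h : Shifted t X) :
    ∂ (X.nonMemberSubfamily t) ⊆ X.memberSubfamily t := by
  intro y hy
  obtain ⟨x, hx, e, he, rfl⟩ := mem_shadow_iff.mp hy
  rw [mem_nonMemberSubfamily] at hx
  rw [mem_memberSubfamily]
  have h1 := h.ge x hx.1 e he
  have h2 : e ≠ t := by rintro rfl; exact hx.2 he
  exact ⟨h.shift x hx.1 t e le_rfl (by omega) he hx.2, by simp [hx.2]⟩

theorem Shifted.nonMemberSubfamily_shadow (h : Shifted t X) :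
    (∂ X).nonMemberSubfamily t = X.memberSubfamily t := by
  ext y
  rw [mem_nonMemberSubfamily, mem_shadow_iff_insert_mem]
  constructor
  · rintro ⟨⟨a, ha, hx⟩, hy⟩
    by_cases hat : a = t
    · subst hat
      exact mem_memberSubfamily.mpr ⟨hx, ha⟩
    · refine h.shadow_nonMemberSubfamily_subset (mem_shadow_iff_insert_mem.mpr ⟨a, ha, ?_⟩)
      exact mem_nonMemberSubfamily.mpr ⟨hx, by simp [hy, Ne.symm hat]⟩
  · intro hy
    rw [mem_memberSubfamily] at hy
    exact ⟨⟨t, hy.2, hy.1⟩, hy.2⟩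

/-- The shadow sets avoiding `t` form the link of `t`; those containing `t` are, without `t`, the
shadow of the link. -/
theorem Shifted.card_shadow (h : Shifted t X) :
    #(∂ X) = #(X.memberSubfamily t) + #(∂ (X.memberSubfamily t)) := by
  rw [← card_memberSubfamily_add_card_nonMemberSubfamily t (∂ X), memberSubfamily_shadow,
    h.nonMemberSubfamily_shadow, add_comm]

/-- If the link were smaller, the deletion would exceed its share in Pascal's rule, and its shadow,
which lies in the link, would be too large. -/
theorem Shifted.le_card_memberSubfamily (h : Shifted t X) (hX : ∀ x ∈ X, #x = m + 1) (hl : Dec l)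
    (h1 : ∀ c ∈ l, 1 ≤ c) (hcard : cas (m + 1) l ≤ #X) :
    cas m (low l) ≤ #(X.memberSubfamily t) := by
  by_contra! hlt
  have h2 := card_memberSubfamily_add_card_nonMemberSubfamily t X
  have h3 := cas_eq_add_low (m := m + 1) h1
  rw [casShadow_succ] at h3
  have h4 := casShadow_le_card_shadow_of_lt (card_of_mem_nonMemberSubfamily (t := t) hX)
    (hl.low h1) (by omega)
  have h5 := card_le_card h.shadow_nonMemberSubfamily_subset
  rw [casShadow_succ] at h4
  omega

/-- In a shifted family with minimum shadow, the numbers of sets that contain the first vertex and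
that do not are determined. -/
theorem Shifted.card_memberSubfamily (h : Shifted t X) (hX : ∀ x ∈ X, #x = m + 1) (hl : Dec l)
    (h1 : ∀ c ∈ l, 1 ≤ c) (hcard : #X = cas (m + 1) l) (hsh : #(∂ X) ≤ cas m l) :
    #(X.memberSubfamily t) = cas m (low l) ∧ #(X.nonMemberSubfamily t) = cas (m + 1) (low l) ∧
      #(∂ (X.memberSubfamily t)) ≤ casShadow m (low l) := by
  have h2 := h.le_card_memberSubfamily hX hl h1 hcard.ge
  have h3 := cas_eq_add_low (m := m) h1
  have h4 := h.card_shadow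
  have h5 : #(X.memberSubfamily t) = cas m (low l) := by
    refine le_antisymm ?_ h2
    -- A link that is too large still has shadow at least `casShadow m (low l)`, and `h.card_shadow`
    -- then exceeds `cas m l`.
    by_contra! hlt
    have := casShadow_le_card_shadow_of_lt (card_of_mem_memberSubfamily (t := t) hX)
      (hl.low h1) hlt
    omega
  have h6 := card_memberSubfamily_add_card_nonMemberSubfamily t X
  have h7 := cas_eq_add_low (m := m + 1) h1
  rw [casShadow_succ] at h7
  exact ⟨h5, by omega, by omega⟩

/-- If the cascade is not full, a family with minimum shadow contains every set all of whose
shadow lies in its shadow. -/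
theorem mem_of_erase_mem_shadow (hX : ∀ x ∈ X, #x = m) (hl : Dec l) (hnd : Nondeg m l)
    (hlen : l.length < m) (hcard : #X = cas m l) (hsh : #(∂ X) ≤ casShadow m l) {x : Finset ℕ}
    (hx : #x = m) (hsub : ∀ e ∈ x, x.erase e ∈ ∂ X) : x ∈ X := by
  by_contra hxX
  -- Adding `x` would not enlarge the shadow, which is impossible past a cascade that is not full.
  have h1 : ∂ (insert x X) ⊆ ∂ X := by
    intro y hy
    obtain ⟨z, hz, e, he, rfl⟩ := mem_shadow_iff.mp hy
    obtain rfl | hz := mem_insert.mp hz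
    · exact hsub e he
    · exact erase_mem_shadow hz he
  have h2 := casShadow_lt_card_shadow (F := insert x X) (by simpa [hx] using hX) hl hnd hlen
    (by rw [card_insert_of_notMem hxX]; omega)
  have := card_le_card h1
  omega

/-! ### Initial segments, their shadows and their links -/

theorem DownClosed.mem_of_le (h : DownClosed t X) {x y : Finset ℕ} (hx : x ∈ X) (hc : #y = #x)
    (hy : ∀ e ∈ y, t ≤ e) (hle : toColex y ≤ toColex x) : y ∈ X := by
  obtain heq | hlt := hle.eq_or_lt
  · rwa [toColex_inj.mp heq]
  · exact h x hx y hc hy (colexLT_iff.mpr hlt)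

theorem DownClosed.shadow (h : DownClosed t X) (hX : ∀ x ∈ X, #x = m + 1)
    (hge : ∀ x ∈ X, ∀ e ∈ x, t ≤ e) : DownClosed t (∂ X) := by
  rintro z hz y hyz hy ⟨k, hkz, hky, hk⟩
  have hzm := card_of_mem_shadow hX z hz
  obtain ⟨e, he, hx⟩ := mem_shadow_iff_insert_mem.mp hz
  have hxm := hX _ hx
  have htk : t ≤ k := hge _ hx k (by simp [hkz])
  have hex : ∃ a, t ≤ a ∧ a ∉ y := ⟨k, htk, hky⟩
  -- Adding the least admissible point missing from `y` gives the colex-smallest extension of `y`.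
  set a := Nat.find hex with ha
  obtain ⟨hta, hay⟩ : t ≤ a ∧ a ∉ y := Nat.find_spec hex
  have hmin : ∀ b, t ≤ b → b < a → b ∈ y := by
    intro b hb hba
    by_contra hby
    exact Nat.find_min hex hba ⟨hb, hby⟩
  have hak : a ≤ k := Nat.find_min' hex ⟨htk, hky⟩
  refine mem_shadow_iff_insert_mem.mpr ⟨a, hay, ?_⟩
  have hcard : #(insert a y) = #(insert e z) := by
    rw [card_insert_of_notMem hay, card_insert_of_notMem he, hyz]
  have hge' : ∀ b ∈ insert a y, t ≤ b := by
    simpa [hta] using hy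
  have hek : e ≠ k := by rintro rfl; exact he hkz
  rcases lt_or_gt_of_ne hek with hek | hek
  · rcases hak.lt_or_eq with hak | hak
    · refine h _ hx _ hcard hge' ⟨k, by simp [hkz], by simp [hky]; omega, fun b hb => ?_⟩
      have := hk b hb
      simp only [mem_insert, this]
      constructor <;> rintro (h1 | h1) <;> first | omega | exact Or.inr h1
    · convert hx using 1
      refine (eq_of_subset_of_card_le (fun b hb => ?_) hcard.le).symm
      rcases lt_trichotomy b a with hba | hba | hba
      · exact mem_insert_of_mem (hmin b (hge _ hx b hb) hba)
      · simp [hba]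
      · refine mem_insert_of_mem ((hk b (by omega)).mpr ?_)
        obtain h1 | h1 := mem_insert.mp hb
        · omega
        · exact h1
  · refine h _ hx _ hcard hge' ⟨e, by simp, ?_, fun b hb => ?_⟩
    · have := hk e hek
      simp only [mem_insert, this, he, or_false]
      omega
    · have := hk b (by omega)
      simp only [mem_insert, this]
      constructor <;> rintro (h1 | h1) <;> first | omega | exact Or.inr h1

/-- A shifted family with minimum shadow is an initial segment if the link of the first vertex
is one. -/
theorem Shifted.downClosed_of_memberSubfamily (h : Shifted t X) (hX : ∀ x ∈ X, #x = m + 1)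
    (hclosed : ∀ x : Finset ℕ, #x = m + 1 → (∀ e ∈ x, x.erase e ∈ ∂ X) → x ∈ X)
    (hdown : DownClosed (t + 1) (X.memberSubfamily t)) : DownClosed t X := by
  intro x hx y hyx hy hlt
  have hxm := hX x hx
  have hxne : x.Nonempty := card_pos.mp (by omega)
  have hyne : y.Nonempty := card_pos.mp (by omega)
  have hx1 : x.erase (x.min' hxne) ∈ X.memberSubfamily t := by
    by_cases htx : t ∈ x
    · have : x.min' hxne = t :=
        le_antisymm (min'_le x t htx) (h.ge x hx _ (min'_mem x hxne))
      rw [this, mem_memberSubfamily, insert_erase htx]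
      exact ⟨hx, by simp⟩
    · exact h.shadow_nonMemberSubfamily_subset
        (erase_mem_shadow (mem_nonMemberSubfamily.mpr ⟨hx, htx⟩) (min'_mem x hxne))
  have hc1 : #(x.erase (x.min' hxne)) = m := by
    rw [card_erase_of_mem (min'_mem x hxne), hxm, Nat.add_sub_cancel]
  -- Removing any element of `y` leaves a set that is at most `x` without its minimum, and the
  -- latter is in the link.
  by_cases hty : t ∈ y
  · have : y.erase t ∈ X.memberSubfamily t := by
      refine hdown.mem_of_le hx1 (by rw [card_erase_of_mem hty]; omega) (fun e he => ?_)
        (Finset.Colex.erase_le_erase_min' (colexLT_iff.mp hlt).le hyx.le hty)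
      obtain ⟨h1, h2⟩ := mem_erase.mp he
      have := hy e h2
      omega
    rw [mem_memberSubfamily, insert_erase hty] at this
    exact this.1
  · refine hclosed y (by omega) fun e he => memberSubfamily_subset_shadow (t := t) ?_
    refine hdown.mem_of_le hx1 (by rw [card_erase_of_mem he]; omega) (fun a ha => ?_)
        (Finset.Colex.erase_le_erase_min' (colexLT_iff.mp hlt).le hyx.le he)
    have h1 := mem_of_mem_erase ha
    have h2 := hy a h1
    have h3 : a ≠ t := by rintro rfl; exact hty h1
    omega

/-- The last entry is at least 2. If it is larger, then by strict decrease every entry exceeds its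
lower bound, so lowering does no harm. -/
theorem Nondeg.low_or_exists {m : ℕ} {l : List ℕ} (h : Dec l) (hl : Nondeg (m + 1) l)
    (hlen : l.length = m) : Nondeg (m + 1) (Cascade.low l) ∨ ∃ l', l = l' ++ [2] := by
  induction l generalizing m with
  | nil => simp
  | cons c l ih =>
    obtain ⟨m, rfl⟩ : ∃ m', m = m' + 1 := ⟨m - 1, by simp at hlen; omega⟩
    simp only [List.length_cons, Nat.add_right_cancel_iff] at hlen
    rw [nondeg_succ_cons] at hl
    rcases l with _ | ⟨d, l⟩
    · simp only [List.length_nil] at hlen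
      subst hlen
      by_cases hc : c = 2
      · exact Or.inr ⟨[], by simp [hc]⟩
      · left
        simp only [List.map_cons, List.map_nil, nondeg_succ_cons, nondeg_nil, and_true]
        omega
    · rcases ih h.of_cons hl.2 hlen with h1 | ⟨l', h1⟩
      · left
        have hcd : d < c := by simpa using (List.pairwise_cons.mp h).1 d (by simp)
        simp only [List.map_cons, nondeg_succ_cons] at h1 ⊢
        exact ⟨by omega, h1⟩
      · exact Or.inr ⟨c :: l', by rw [h1, List.cons_append]⟩

end JohnsonIso.Cascade

/-! ### Shifted families whose cascade ends in 2: a removable set -/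

namespace JohnsonIso.Cascade

open Finset
open scoped FinsetFamily

variable {m t : ℕ} {l : List ℕ} {X : Finset (Finset ℕ)}

theorem Shifted.memberSubfamily_nonMemberSubfamily_subset (h : Shifted t X) :
    (X.nonMemberSubfamily t).memberSubfamily (t + 1) ⊆
      (X.memberSubfamily t).nonMemberSubfamily (t + 1) := by
  intro y hy
  rw [mem_memberSubfamily, mem_nonMemberSubfamily] at hy
  obtain ⟨⟨h1, h2⟩, h3⟩ := hy
  rw [mem_insert, not_or] at h2
  rw [mem_nonMemberSubfamily, mem_memberSubfamily]
  refine ⟨⟨?_, h2.2⟩, h3⟩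
  have := h.shift _ h1 t (t + 1) le_rfl (by omega) (by simp) (by simp [h2.2])
  rwa [erase_insert h3] at this

/-- The sizes of the pieces of `X` at `t` and `t + 1` are all forced. If the inclusion held, `A`
would be the shadow of `B`. Splitting once more at `t + 2` then gives `A` too large a link, and so
too large a shadow. -/
theorem Shifted.not_memberSubfamily_subset_shadow (h : Shifted t X) {l' : List ℕ}
    (hX : ∀ x ∈ X, #x = m + 2) (hl : Dec (l' ++ [2])) (hlen : l'.length = m)
    (hcard : #X = cas (m + 2) (l' ++ [2])) (hsh : #(∂ X) ≤ cas (m + 1) (l' ++ [2])) :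
    ¬ (X.memberSubfamily t).memberSubfamily (t + 1) ⊆
      ∂ ((X.memberSubfamily t).nonMemberSubfamily (t + 1)) := by
  intro hAB
  have hl' : Dec l' := (List.pairwise_append.mp hl).1
  have hge : ∀ c ∈ l', 2 < c := fun c hc => by
    simpa using (List.pairwise_append.mp hl).2.2 c hc 2 (by simp)
  have hge1 : ∀ c ∈ l', 1 ≤ c := fun c hc => by have := hge c hc; omega
  have hlow1 : ∀ c ∈ low l', 1 ≤ c := by
    intro c hc
    obtain ⟨d, hd, rfl⟩ := List.mem_map.mp hc
    have := hge d hd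
    omega
  have hlow2 : ∀ c ∈ low (low l'), 1 ≤ c := by
    intro c hc
    obtain ⟨b, hb, rfl⟩ := List.mem_map.mp hc
    obtain ⟨d, hd, rfl⟩ := List.mem_map.mp hb
    have := hge d hd
    omega
  have hlow : low (l' ++ [2]) = low l' ++ [1] := by simp
  have hlow' : low (low l' ++ [1]) = low (low l') ++ [0] := by simp
  have hd1 : Dec (low l' ++ [1]) := by
    rw [← hlow]
    refine hl.low fun c hc => ?_
    rcases List.mem_append.mp hc with hc | hc
    · exact hge1 c hc
    · simp at hc; omega
  have hpos1 : ∀ c ∈ low l' ++ [1], 1 ≤ c := by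
    intro c hc
    rcases List.mem_append.mp hc with hc | hc
    · exact hlow1 c hc
    · simp at hc; omega
  set g := low (low l') with hg
  have hglen : g.length = m := by simp [hg, hlen]
  have hdg : Dec g := (hl'.low hge1).low hlow1
  set Y := X.memberSubfamily t with hY
  set Z := X.nonMemberSubfamily t with hZ
  set A := Y.memberSubfamily (t + 1) with hA
  set B := Y.nonMemberSubfamily (t + 1) with hB
  have hYm : ∀ x ∈ Y, #x = m + 1 := card_of_mem_memberSubfamily hX
  have hZm : ∀ x ∈ Z, #x = m + 2 := card_of_mem_nonMemberSubfamily hX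
  have hYs : Shifted (t + 1) Y := h.memberSubfamily
  have hZs : Shifted (t + 1) Z := h.nonMemberSubfamily
  obtain ⟨y1, y2, y3⟩ := h.card_memberSubfamily hX hl (fun c hc => by
    rcases List.mem_append.mp hc with hc | hc
    · exact hge1 c hc
    · simp at hc; omega) hcard hsh
  rw [hlow] at y1 y2 y3
  change #Y = _ at y1
  change #Z = _ at y2
  change #(∂ Y) ≤ _ at y3
  obtain ⟨a1, a2, a3⟩ := hYs.card_memberSubfamily hYm hd1 hpos1 y1 y3
  rw [hlow'] at a1 a2 a3
  -- The entry 2, lowered twice, is 0. It counts `C(0, 0) = 1` at level `m` and nothing at level `m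
  -- + 1`.
  have e1 : cas m (g ++ [0]) = cas m g + 1 := by
    rw [cas_append_singleton _ _ _ hglen.le, hglen]; simp
  have e2 : cas (m + 1) (g ++ [0]) = cas (m + 1) g := by
    rw [cas_append_singleton _ _ _ (by omega), hglen]; simp
  have e3 : casShadow m (g ++ [0]) = casShadow m g := by
    rcases m with _ | m
    · rfl
    · exact cas_append_of_lt _ _ _ (by omega)
  have e4 : cas (m + 2) (low l' ++ [1]) = cas (m + 2) (low l') := by
    rw [cas_append_singleton _ _ _ (by simp; omega)]; simp [hlen]
  change #A = _ at a1
  change #B = _ at a2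
  change #(∂ A) ≤ _ at a3
  rw [e1] at a1
  rw [e2] at a2
  rw [e3] at a3
  rw [e4] at y2
  -- the sets without the first vertex
  have hB'B : Z.memberSubfamily (t + 1) ⊆ B := h.memberSubfamily_nonMemberSubfamily_subset
  have b1 := hZs.le_card_memberSubfamily hZm (hl'.low hge1) hlow1 y2.ge
  change cas (m + 1) g ≤ _ at b1
  have hB' : Z.memberSubfamily (t + 1) = B := eq_of_subset_of_card_le hB'B (by omega)
  set D := Z.nonMemberSubfamily (t + 1) with hD
  have hDs : Shifted (t + 2) D := hZs.nonMemberSubfamily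
  have hDm : ∀ x ∈ D, #x = m + 2 := card_of_mem_nonMemberSubfamily hZm
  have hDB : ∂ D ⊆ B := hB' ▸ hZs.shadow_nonMemberSubfamily_subset
  have d1 : #D = cas (m + 2) g := by
    have h1 := card_memberSubfamily_add_card_nonMemberSubfamily (t + 1) Z
    have h2 := cas_eq_add_low (m := m + 2) hlow1
    rw [casShadow_succ] at h2
    change _ = cas (m + 2) g + cas (m + 1) g at h2
    change _ + #D = #Z at h1
    rw [hB'] at h1
    omega
  have d2 := hDs.le_card_memberSubfamily hDm hdg hlow2 d1.ge
  have hBs : Shifted (t + 2) B := hYs.nonMemberSubfamily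
  have hBm : ∀ x ∈ B, #x = m + 1 := card_of_mem_nonMemberSubfamily hYm
  -- The link of `t + 2` in `D` consists of sets of `B` avoiding `t + 2`; as there are many of
  -- these, few sets of `B` contain `t + 2`.
  have d3 : #(B.memberSubfamily (t + 2)) ≤ cas m (low g) := by
    have h1 : D.memberSubfamily (t + 2) ⊆ B.nonMemberSubfamily (t + 2) := by
      intro y hy
      exact mem_nonMemberSubfamily.mpr ⟨hDB (memberSubfamily_subset_shadow hy),
        (mem_memberSubfamily.mp hy).2⟩
    have h2 := card_le_card h1
    have h3 := card_memberSubfamily_add_card_nonMemberSubfamily (t + 2) B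
    have h4 := cas_eq_add_low (m := m + 1) hlow2
    rw [casShadow_succ] at h4
    omega
  have hAeq : A = ∂ B := hAB.antisymm hYs.shadow_nonMemberSubfamily_subset
  have hAs : Shifted (t + 2) A := hYs.memberSubfamily
  have hAm : ∀ x ∈ A, #x = m := card_of_mem_memberSubfamily hYm
  -- Since `A = ∂ B`, the sets of `A` avoiding `t + 2` are the link of `t + 2` in `B`, which is
  -- small by `d3`; the rest of `A` must contain `t + 2`.
  have d4 : casShadow m (low g) < #(A.memberSubfamily (t + 2)) := by
    have h1 := card_memberSubfamily_add_card_nonMemberSubfamily (t + 2) A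
    have h2 : A.nonMemberSubfamily (t + 2) = B.memberSubfamily (t + 2) := by
      rw [hAeq, hBs.nonMemberSubfamily_shadow]
    have h3 := cas_eq_add_low (m := m) hlow2
    rw [h2] at h1
    omega
  have d5 := hAs.card_shadow
  rcases m with _ | m
  · simp only [casShadow_zero] at a3 d4
    omega
  · have h1 := casShadow_le_card_shadow_of_lt (card_of_mem_memberSubfamily (t := t + 2) hAm)
      (hdg.low hlow2) d4
    have h2 := cas_eq_add_low (m := m) hlow2
    simp only [casShadow_succ] at a3 d4
    omega

/-- The set `insert t (insert (t + 1) y)` can be removed from a shifted family. -/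
theorem Shifted.exists_erase (h : Shifted t X)
    (hAB : ¬ (X.memberSubfamily t).memberSubfamily (t + 1) ⊆
      ∂ ((X.memberSubfamily t).nonMemberSubfamily (t + 1))) :
    ∃ x ∈ X, t ∈ x ∧ t + 1 ∈ x ∧ Shifted t (X.erase x) ∧ #(∂ (X.erase x)) + 2 ≤ #(∂ X) := by
  set Y := X.memberSubfamily t with hY
  set A := Y.memberSubfamily (t + 1) with hA
  set B := Y.nonMemberSubfamily (t + 1) with hB
  have hBs : Shifted (t + 2) B := h.memberSubfamily.nonMemberSubfamily
  have hAs : Shifted (t + 2) A := h.memberSubfamily.memberSubfamily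
  have memA : ∀ y, y ∈ A ↔ insert t (insert (t + 1) y) ∈ X ∧ t ∉ y ∧ t + 1 ∉ y := by
    intro y
    rw [hA, mem_memberSubfamily, hY, mem_memberSubfamily, mem_insert, not_or]
    simp [and_assoc]
  have memB : ∀ y, y ∈ B ↔ insert t y ∈ X ∧ t ∉ y ∧ t + 1 ∉ y := by
    intro y
    rw [hB, mem_nonMemberSubfamily, hY, mem_memberSubfamily, and_assoc]
  have hne : (A \ ∂ B).Nonempty := sdiff_nonempty.mpr (by assumption)
  -- As `y ∉ ∂ B`, both `insert t y` and `insert (t + 1) y` are covered by the removed set alone.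
  -- Maximality keeps the family shifted: a set that shifts onto the removed one by a change inside
  -- `y` would give a larger candidate `y'`.
  obtain ⟨y, hy, hmax⟩ := exists_max_image (A \ ∂ B) (fun y => toColex y) hne
  obtain ⟨hyA, hyB⟩ := mem_sdiff.mp hy
  obtain ⟨hyX, hty, hty'⟩ := (memA y).mp hyA
  have hyge : ∀ e ∈ y, t + 2 ≤ e := hAs.ge y hyA
  -- no set of `X` contains `y`, `t + 1` and a vertex other than `t`
  have priv1 : ∀ a, a ≠ t → a ∉ insert (t + 1) y → insert a (insert (t + 1) y) ∉ X := by
    intro a hat hay hX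
    rw [mem_insert, not_or] at hay
    have h1 : insert a y ∈ (X.nonMemberSubfamily t).memberSubfamily (t + 1) := by
      rw [mem_memberSubfamily, mem_nonMemberSubfamily, Finset.insert_comm]
      exact ⟨⟨hX, by simp [hty, Ne.symm hat]⟩, by simp [hty', Ne.symm hay.1]⟩
    exact hyB (mem_shadow_iff_insert_mem.mpr
      ⟨a, hay.2, h.memberSubfamily_nonMemberSubfamily_subset h1⟩)
  have priv2 : ∀ a, a ≠ t + 1 → a ∉ insert t y → insert a (insert t y) ∉ X := by
    intro a hat hay hX
    rw [mem_insert, not_or] at hay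
    refine hyB (mem_shadow_iff_insert_mem.mpr ⟨a, hay.2, (memB _).mpr ⟨?_, ?_, ?_⟩⟩)
    · rwa [Finset.insert_comm]
    · simp [hty, Ne.symm hay.1]
    · simp [hty', Ne.symm hat]
  refine ⟨_, hyX, by simp, by simp, ⟨fun x hx => h.ge x (mem_of_mem_erase hx), ?_⟩, ?_⟩
  · intro x hx i j hi hij hj hix
    rw [mem_erase] at hx ⊢
    refine ⟨fun heq => ?_, h.shift x hx.2 i j hi hij hj hix⟩
    have hxj : j ∉ insert t (insert (t + 1) y) := by
      rw [← heq]; simp; omega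
    have hii : i ∈ insert t (insert (t + 1) y) := by
      rw [← heq]; simp
    have hxeq : x = insert j ((insert t (insert (t + 1) y)).erase i) := by
      rw [← heq, erase_insert (by simp [hix]), insert_erase hj]
    simp only [mem_insert, not_or] at hxj hii
    have hxX := hx.2
    rw [hxeq] at hxX
    obtain rfl | rfl | hiy := hii
    · rw [erase_insert (by simp [hty])] at hxX
      exact priv1 j hxj.1 (by simp [hxj]) hxX
    · rw [erase_insert_of_ne (by omega), erase_insert hty'] at hxX
      exact priv2 j hxj.2.1 (by simp [hxj]) hxX
    · have hi2 := hyge i hiy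
      rw [erase_insert_of_ne (by omega), erase_insert_of_ne (by omega)] at hxX
      set y' := insert j (y.erase i) with hy'
      have hy'A : y' ∈ A := by
        rw [memA]
        refine ⟨?_, ?_, ?_⟩
        · rw [hy', Finset.insert_comm (t + 1) j, Finset.insert_comm t j]
          exact hxX
        · simp [hy', hty, Ne.symm hxj.1]
        · simp [hy', hty', Ne.symm hxj.2.1]
      -- If `y'` is in the shadow of `B`, then so is `y`, because `B` is shifted.
      by_cases hy'B : y' ∈ ∂ B
      · obtain ⟨a, ha, haB⟩ := mem_shadow_iff_insert_mem.mp hy'B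
        refine hyB (mem_shadow_iff_insert_mem.mpr ?_)
        simp only [hy', mem_insert, mem_erase, not_or, not_and] at ha
        by_cases hai : a = i
        · subst hai
          refine ⟨j, hxj.2.2, ?_⟩
          rwa [hy', Finset.insert_comm, insert_erase hiy] at haB
        · refine ⟨a, ha.2 hai, ?_⟩
          have := hBs.shift _ haB i j hi2 hij (by simp [hy'])
            (by simp [hy', hij.ne, Ne.symm hai])
          convert this using 1
          rw [erase_insert_of_ne ha.1, hy', erase_insert (by simp [hxj.2.2]),
            Finset.insert_comm, insert_erase hiy]
      · have h1 := hmax y' (mem_sdiff.mpr ⟨hy'A, hy'B⟩)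
        refine absurd h1 (not_le.mpr (colexLT_iff.mp ⟨j, by simp [hy'], hxj.2.2, fun a ha => ?_⟩))
        simp only [hy', mem_insert, mem_erase]
        constructor
        · intro h2; exact Or.inr ⟨by omega, h2⟩
        · rintro (h2 | h2)
          · omega
          · exact h2.2
  · have hsub : insert (insert t y) (insert (insert (t + 1) y)
        (∂ (X.erase (insert t (insert (t + 1) y))))) ⊆ ∂ X := by
      refine insert_subset ?_ (insert_subset ?_ (shadow_mono (erase_subset _ _)))
      · refine mem_shadow_iff_insert_mem.mpr ⟨t + 1, by simp [hty'], ?_⟩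
        rwa [Finset.insert_comm]
      · exact mem_shadow_iff_insert_mem.mpr ⟨t, by simp [hty], hyX⟩
    have h2 := card_le_card hsub
    rw [card_insert_of_notMem, card_insert_of_notMem] at h2
    · exact h2
    · intro h3
      obtain ⟨a, ha, haX⟩ := mem_shadow_iff_insert_mem.mp h3
      rw [mem_erase] at haX
      by_cases hat : a = t
      · subst hat; exact haX.1 rfl
      · exact priv1 a hat ha haX.2
    · rw [mem_insert, not_or]
      constructor
      · intro h3
        have : t ∈ insert (t + 1) y := h3 ▸ mem_insert_self t y
        simp [hty] at this
      · intro h3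
        obtain ⟨a, ha, haX⟩ := mem_shadow_iff_insert_mem.mp h3
        rw [mem_erase] at haX
        by_cases hat : a = t + 1
        · subst hat; exact haX.1 (Finset.insert_comm _ _ _)
        · exact priv2 a hat ha haX.2

end JohnsonIso.Cascade

/-! ### Shifted families with minimum shadow are initial segments -/

namespace JohnsonIso.Cascade

open Finset
open scoped FinsetFamily

variable {m t : ℕ} {l : List ℕ} {X : Finset (Finset ℕ)}

/-- A first set in the colex order that is missing from a family. -/
theorem exists_first_notMem {x : Finset ℕ} (hxX : x ∉ X) (hx : ∀ e ∈ x, t ≤ e) :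
    ∃ c, #c = #x ∧ (∀ e ∈ c, t ≤ e) ∧ c ∉ X ∧ toColex c ≤ toColex x ∧
      ∀ z : Finset ℕ, #z = #x → (∀ e ∈ z, t ≤ e) → ColexLT z c → z ∈ X := by
  obtain ⟨n, hn⟩ : ∃ n, ∀ e ∈ x, e < n :=
    ⟨x.sup id + 1, fun e he => Nat.lt_succ_of_le (le_sup (f := id) he)⟩
  set U := (powersetCard #x (range n)).filter fun z => (∀ e ∈ z, t ≤ e) ∧ z ∉ X with hU
  have memU : ∀ z, z ∈ U ↔ ((∀ e ∈ z, e < n) ∧ #z = #x) ∧ (∀ e ∈ z, t ≤ e) ∧ z ∉ X := by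
    intro z
    simp [hU, mem_powersetCard, subset_iff]
  have hxU : x ∈ U := (memU x).mpr ⟨⟨hn, rfl⟩, hx, hxX⟩
  obtain ⟨c, hc, hmin⟩ := exists_min_image U (fun z => toColex z) ⟨x, hxU⟩
  obtain ⟨⟨h1, h2⟩, h3, h4⟩ := (memU c).mp hc
  refine ⟨c, h2, h3, h4, hmin x hxU, fun z hz hzt hlt => ?_⟩
  by_contra hzX
  rw [colexLT_iff] at hlt
  refine absurd (hmin z ((memU z).mpr ⟨⟨?_, hz⟩, hzt, hzX⟩)) hlt.not_ge
  exact Finset.Colex.forall_lt_mono hlt.le h1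

/-- The first set `c` missing from `X.erase x₀` must contain `t` and `t + 1`, since it contributes
two new shadow sets. If `x₀` were not `c`, the bound of two new shadow sets for `x₀` would make `c`
arise from `x₀` by lowering one element, so that shiftedness would put `c` into `X`. -/
theorem Shifted.downClosed_of_erase (h : Shifted t X) {l' : List ℕ} (hX : ∀ x ∈ X, #x = m + 2)
    (hl : Dec (l' ++ [2])) (hnd : Nondeg (m + 2) (l' ++ [2])) (hlen : l'.length = m)
    (hsh : #(∂ X) ≤ cas (m + 1) (l' ++ [2])) {x₀ : Finset ℕ} (hx₀ : x₀ ∈ X) (ht : t ∈ x₀)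
    (ht' : t + 1 ∈ x₀) (hcard : #(X.erase x₀) = cas (m + 2) l')
    (hsh' : #(∂ (X.erase x₀)) ≤ cas (m + 1) l') (hdown : DownClosed t (X.erase x₀)) :
    DownClosed t X := by
  intro x hx y hyx hy hlt
  by_contra hyX
  obtain rfl | hne := eq_or_ne x x₀
  swap
  · exact hyX (mem_of_mem_erase (hdown x (mem_erase.mpr ⟨hne, hx⟩) y hyx hy hlt))
  set F := X.erase x with hF
  have hFm : ∀ z ∈ F, #z = m + 2 := fun z hz => hX z (mem_of_mem_erase hz)
  have hxm := hX x hx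
  have hyF : y ∉ F := fun hyF => hyX (mem_of_mem_erase hyF)
  obtain ⟨c, hcy, hct, hcF, hcle, hcmin⟩ := exists_first_notMem hyF hy
  have hcm : #c = m + 2 := by omega
  have hcx : ColexLT c x := colexLT_iff.mpr (hcle.trans_lt (colexLT_iff.mp hlt))
  have e1 : cas (m + 1) (l' ++ [2]) = cas (m + 1) l' + 2 := by
    rw [cas_append_singleton _ _ _ (by omega), hlen]; simp
  have e2 : cas (m + 2) (l' ++ [2]) = cas (m + 2) l' + 1 := by
    rw [cas_append_singleton _ _ _ (by omega), hlen]; simp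
  -- the first missing set contains the first two vertices
  set N := c.filter fun e => c.erase e ∉ ∂ F with hN
  have hN2 : 2 ≤ #N := by
    have h1 := casShadow_le_card_shadow (F := insert c F) (m := m + 2) (by simpa [hcm] using hFm)
      hl hnd (by rw [card_insert_of_notMem hcF]; omega)
    have h2 : ∂ (insert c F) ⊆ ∂ F ∪ N.image c.erase := by
      intro z hz
      obtain ⟨w, hw, e, he, rfl⟩ := mem_shadow_iff.mp hz
      obtain rfl | hw := mem_insert.mp hw
      · rw [mem_union]
        by_cases h3 : w.erase e ∈ ∂ F
        · exact Or.inl h3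
        · exact Or.inr (mem_image_of_mem _ (mem_filter.mpr ⟨he, h3⟩))
      · exact mem_union_left _ (erase_mem_shadow hw he)
    have h3 := card_le_card h2
    have h4 := card_union_le (∂ F) (N.image c.erase)
    have h5 := card_image_le (s := N) (f := c.erase)
    rw [casShadow_succ] at h1
    omega
  -- If `a` were missing from `c`, replacing `e` by `a` would give an earlier set, hence a member of
  -- `F`, with `c.erase e` in its shadow.
  have hNlt : ∀ e ∈ N, ∀ a, t ≤ a → a < e → a ∈ c := by
    intro e he a hta hae
    by_contra hac
    obtain ⟨hec, heF⟩ := mem_filter.mp he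
    refine heF (mem_shadow_iff_insert_mem.mpr ⟨a, by simp [hac], hcmin _ ?_ ?_ ⟨e, hec, ?_, ?_⟩⟩)
    · rw [card_insert_of_notMem (by simp [hac]), card_erase_of_mem hec]
      omega
    · intro b hb
      obtain rfl | hb := mem_insert.mp hb
      · exact hta
      · exact hct b (mem_of_mem_erase hb)
    · simp; omega
    · intro b hb
      rw [mem_insert, mem_erase]
      constructor
      · rintro (h1 | h1)
        · omega
        · exact h1.2
      · intro h1; exact Or.inr ⟨by omega, h1⟩
  obtain ⟨a, b, ha, hb, hab⟩ : ∃ a b, a ∈ N ∧ b ∈ N ∧ a < b := by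
    obtain ⟨a, ha, b, hb, hab⟩ := one_lt_card.mp hN2
    rcases lt_or_gt_of_ne hab with h1 | h1
    · exact ⟨a, b, ha, hb, h1⟩
    · exact ⟨b, a, hb, ha, h1⟩
  have hat := hct a (mem_filter.mp ha).1
  have htc : t ∈ c := hNlt b hb t le_rfl (by omega)
  have htc' : t + 1 ∈ c := by
    rcases (show t + 1 ≤ b by omega).eq_or_lt with h1 | h1
    · rw [h1]; exact (mem_filter.mp hb).1
    · exact hNlt b hb _ (by omega) h1
  -- compare with the removed set
  obtain ⟨p, hpx, hpc, hp⟩ := hcx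
  -- A set of `F` containing `x.erase e` would come after `c`, and `F`, being an initial segment,
  -- would contain `c`.
  have hnew : ∀ e ∈ x, e < p → x.erase e ∉ ∂ F := by
    intro e he hep hmem
    obtain ⟨a, ha, haF⟩ := mem_shadow_iff_insert_mem.mp hmem
    refine hcF (hdown _ haF c (by rw [hcm, hFm _ haF]) hct ?_)
    by_cases hap : p < a ∧ a ∉ x
    · refine ⟨a, by simp, fun h1 => hap.2 ((hp a hap.1).mp h1), fun b hb => ?_⟩
      rw [hp b (by omega), mem_insert, mem_erase]
      constructor
      · intro h1; exact Or.inr ⟨by omega, h1⟩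
      · rintro (h1 | h1)
        · omega
        · exact h1.2
    · refine ⟨p, by simp [hpx]; omega, hpc, fun b hb => ?_⟩
      rw [hp b hb, mem_insert, mem_erase]
      constructor
      · intro h1; exact Or.inr ⟨by omega, h1⟩
      · rintro (rfl | h1)
        · by_contra h2; exact hap ⟨hb, h2⟩
        · exact h1.2
  -- A third element below `p` would yield three new shadow sets, but the sizes leave room for two.
  have hlow : ∀ e ∈ x, e < p → e = t ∨ e = t + 1 := by
    intro e he hep
    by_contra! hne
    have hxt := h.ge x hx
    have htp : t < p := lt_of_le_of_ne (hxt p hpx) (by rintro rfl; exact hpc htc)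
    have htp' : t + 1 < p := lt_of_le_of_ne htp (by rintro rfl; exact hpc htc')
    have h1 : #(({t, t + 1, e} : Finset ℕ).image x.erase) = 3 := by
      rw [card_image_of_injOn]
      · rw [card_insert_of_notMem, card_pair] <;> simp <;> omega
      · refine (erase_injOn x).mono ?_
        simp [Set.insert_subset_iff, ht, ht', he]
    have h2 : Disjoint (({t, t + 1, e} : Finset ℕ).image x.erase) (∂ F) := by
      rw [disjoint_left]
      intro z hz
      simp only [mem_image, mem_insert, mem_singleton] at hz
      obtain ⟨b, rfl | rfl | rfl, rfl⟩ := hz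
      · exact hnew _ ht htp
      · exact hnew _ ht' htp'
      · exact hnew _ he hep
    have h3 : ({t, t + 1, e} : Finset ℕ).image x.erase ∪ ∂ F ⊆ ∂ X := by
      refine union_subset ?_ (shadow_mono (erase_subset _ _))
      intro z hz
      simp only [mem_image, mem_insert, mem_singleton] at hz
      obtain ⟨b, rfl | rfl | rfl, rfl⟩ := hz <;> exact erase_mem_shadow hx (by assumption)
    have h4 := card_le_card h3
    rw [card_union_of_disjoint h2, h1] at h4
    have h5 := casShadow_le_card_shadow hFm (List.pairwise_append.mp hl).1 hnd.of_append hcard.ge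
    rw [casShadow_succ] at h5
    omega
  obtain ⟨q, hqc, hqx⟩ : ∃ q ∈ c, q ∉ x := by
    by_contra! hsub
    exact hpc ((eq_of_subset_of_card_le hsub (by omega)).symm ▸ hpx)
  have hqp : q < p := by
    rcases lt_trichotomy q p with h1 | rfl | h1
    · exact h1
    · exact absurd hqc hpc
    · exact absurd ((hp q h1).mp hqc) hqx
  have hceq : insert q (x.erase p) = c := by
    refine eq_of_subset_of_card_le (insert_subset hqc fun e he => ?_) ?_
    · obtain ⟨h1, h2⟩ := mem_erase.mp he
      rcases lt_or_gt_of_ne h1 with h1 | h1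
      · obtain rfl | rfl := hlow e h2 h1
        · exact htc
        · exact htc'
      · exact (hp e h1).mpr h2
    · rw [card_insert_of_notMem (by simp [hqx]), card_erase_of_mem hpx]
      omega
  have hcX : c ∈ X := hceq ▸ h.shift x hx q p (hct q hqc) hqp hpx hqx
  refine hcF (mem_erase.mpr ⟨?_, hcX⟩)
  rintro rfl
  exact hpc hpx

/-- A shifted family with minimum shadow is an initial segment of the colex order, if its cascade
is not full. -/
theorem Shifted.downClosed (h : Shifted t X) (hX : ∀ x ∈ X, #x = m) (hl : Dec l)
    (hnd : Nondeg m l) (hlen : l.length < m) (hcard : #X = cas m l)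
    (hsh : #(∂ X) ≤ casShadow m l) : DownClosed t X := by
  induction hN : m + #X using Nat.strong_induction_on generalizing m t l X with
  | _ N ih =>
    subst hN
    rcases l with _ | ⟨c, l⟩
    · rw [cas_nil, card_eq_zero] at hcard
      subst hcard
      simp [DownClosed]
    obtain ⟨m, rfl⟩ : ∃ m', m = m' + 2 := ⟨m - 2, by simp at hlen; omega⟩
    have hcl : 0 < cas (m + 2) (c :: l) := by
      have := Nat.choose_pos (show m + 2 ≤ c from (nondeg_succ_cons _ _ _).mp hnd |>.1)
      have := choose_le_cas (m + 2) c l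
      omega
    set l₀ := c :: l with hl₀
    rw [casShadow_succ] at hsh
    have h1 := hnd.one_le
    obtain ⟨c1, c2, c3⟩ := h.card_memberSubfamily hX hl h1 hcard hsh
    change #(X.nonMemberSubfamily t) = cas (m + 2) (low l₀) at c2
    have hYm := card_of_mem_memberSubfamily (t := t) hX
    have hpas := cas_eq_add_low (m := m + 2) h1
    rw [casShadow_succ] at hpas
    -- The link is nonempty, so the deletion is strictly smaller than `X`, as the induction on the
    -- deletion requires.
    have hYpos : 0 < cas (m + 1) (low l₀) := by
      have h3 : ∀ l' : List ℕ, ∀ d, 0 < cas (m + 1) (d :: l') ∨ d < m + 1 := by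
        intro l' d
        by_cases hd : d < m + 1
        · exact Or.inr hd
        · have := Nat.choose_pos (show m + 1 ≤ d by omega)
          have := choose_le_cas (m + 1) d l'
          left; omega
      rcases h3 (low l) (c - 1) with h4 | h4
      · exact h4
      · have := (nondeg_succ_cons _ _ _).mp hnd |>.1
        omega
    have hclosed := fun (x : Finset ℕ) (hx : #x = m + 2) =>
      mem_of_erase_mem_shadow hX hl hnd hlen hcard hsh (x := x) hx
    rcases Nat.lt_or_ge l₀.length (m + 1) with hlt | hge
    · refine h.downClosed_of_memberSubfamily hX hclosed ?_
      exact ih _ (by omega) h.memberSubfamily hYm (hl.low h1) (hnd.low (by omega))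
        (by simpa using hlt) c1 c3 rfl
    · rcases hnd.low_or_exists hl (by omega) with hnd' | ⟨l', hl'⟩
      · refine h.downClosed_of_memberSubfamily hX hclosed ?_
        have hZm := card_of_mem_nonMemberSubfamily (t := t) hX
        have hsub := h.shadow_nonMemberSubfamily_subset
        -- Kruskal–Katona for the deletion shows that its shadow fills the link.
        have h2 := casShadow_le_card_shadow hZm (hl.low h1) hnd' c2.ge
        rw [casShadow_succ] at h2
        have h3 : ∂ (X.nonMemberSubfamily t) = X.memberSubfamily t :=
          eq_of_subset_of_card_le hsub (c1.le.trans h2)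
        rw [← h3]
        refine DownClosed.shadow (m := m + 1) ?_ hZm h.nonMemberSubfamily.ge
        exact ih _ (by omega) h.nonMemberSubfamily hZm (hl.low h1) hnd' (by simpa using hlen) c2
          (by rw [casShadow_succ]; exact (card_le_card hsub).trans c1.le) rfl
      · rw [hl'] at hl hnd hcard hsh hlen hge
        rw [List.length_append, List.length_singleton] at hlen hge
        have hlen' : l'.length = m := by omega
        -- Removing `x` accounts for the last entry: `C(2, 2) = 1` set and `C(2, 1) = 2` sets of the
        -- shadow.
        obtain ⟨x, hx, htx, htx', hxs, hxsh⟩ := h.exists_erase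
          (h.not_memberSubfamily_subset_shadow hX hl hlen' hcard hsh)
        have e1 : cas (m + 1) (l' ++ [2]) = cas (m + 1) l' + 2 := by
          rw [cas_append_singleton _ _ _ (by omega), hlen']; simp
        have e2 : cas (m + 2) (l' ++ [2]) = cas (m + 2) l' + 1 := by
          rw [cas_append_singleton _ _ _ (by omega), hlen']; simp
        have e3 : #(X.erase x) = cas (m + 2) l' := by
          rw [card_erase_of_mem hx]; omega
        have e4 : #(∂ (X.erase x)) ≤ cas (m + 1) l' := by omega
        refine h.downClosed_of_erase hX hl hnd hlen' hsh hx htx htx' e3 e4 ?_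
        exact ih _ (by omega) hxs (fun z hz => hX z (mem_of_mem_erase hz))
          (List.pairwise_append.mp hl).1 hnd.of_append (by omega) e3 (by simpa using e4) rfl

end JohnsonIso.Cascade

namespace JohnsonIso.Cascade

open Finset
open scoped FinsetFamily

variable {m t : ℕ} {l : List ℕ} {X : Finset (Finset ℕ)}

/-! ### Shifts -/

/-- The family obtained from `X` by replacing `j` by `i` in its sets wherever this is possible. -/
abbrev shiftFam (i j : ℕ) (X : Finset (Finset ℕ)) : Finset (Finset ℕ) :=
  UV.compression {i} {j} X

theorem compress_singleton (i j : ℕ) (x : Finset ℕ) : UV.compress {i} {j} x =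
    if i ∉ x ∧ j ∈ x ∧ i ≠ j then insert i (x.erase j) else x := by
  unfold UV.compress
  by_cases h : i ∉ x ∧ j ∈ x
  · have hij : i ≠ j := by rintro rfl; exact h.1 h.2
    rw [if_pos (by simpa using h), if_pos ⟨h.1, h.2, hij⟩]
    ext a
    simp only [sup_eq_union, mem_sdiff, mem_union, mem_singleton, mem_insert, mem_erase]
    constructor
    · rintro ⟨h1 | h1, h2⟩
      · exact Or.inr ⟨h2, h1⟩
      · exact Or.inl h1
    · rintro (h1 | h1)
      · exact ⟨Or.inr h1, by rw [h1]; exact hij⟩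
      · exact ⟨Or.inl h1.2, h1.1⟩
  · rw [if_neg (by simpa using h), if_neg (fun h' => h ⟨h'.1, h'.2.1⟩)]

theorem insert_left_mem_shiftFam {i j : ℕ} (hij : i ≠ j) {z : Finset ℕ} (hi : i ∉ z)
    (hj : j ∉ z) : insert i z ∈ shiftFam i j X ↔ insert i z ∈ X ∨ insert j z ∈ X := by
  rw [UV.mem_compression, compress_singleton, if_neg (by simp)]
  constructor
  · rintro (⟨h1, -⟩ | ⟨h1, b, hb, h2⟩)
    · exact Or.inl h1
    · rw [compress_singleton] at h2
      split_ifs at h2 with h3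
      · right
        have : b.erase j = z := by
          have := congrArg (fun s => s.erase i) h2
          simpa [hi, h3.1] using this
        rwa [← this, insert_erase h3.2.1]
      · exact Or.inl (h2 ▸ hb)
  · rintro (h1 | h1)
    · exact Or.inl ⟨h1, h1⟩
    · by_cases h2 : insert i z ∈ X
      · exact Or.inl ⟨h2, h2⟩
      · refine Or.inr ⟨h2, _, h1, ?_⟩
        rw [compress_singleton, if_pos ⟨by simp [hi, hij], by simp, hij⟩, erase_insert hj]

theorem insert_right_mem_shiftFam {i j : ℕ} (hij : i ≠ j) {z : Finset ℕ} (hi : i ∉ z)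
    (hj : j ∉ z) : insert j z ∈ shiftFam i j X ↔ insert i z ∈ X ∧ insert j z ∈ X := by
  rw [UV.mem_compression, compress_singleton, if_pos ⟨by simp [hi, hij], by simp, hij⟩,
    erase_insert hj]
  constructor
  · rintro (⟨h1, h2⟩ | ⟨h1, b, hb, h2⟩)
    · exact ⟨h2, h1⟩
    · rw [compress_singleton] at h2
      split_ifs at h2 with h3
      · have : i ∈ insert j z := h2 ▸ mem_insert_self i _
        simp [hi, hij] at this
      · exact absurd (h2 ▸ hb) h1
  · exact fun h => Or.inl ⟨h.2, h.1⟩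

theorem mem_shiftFam_of_iff {i j : ℕ} {x : Finset ℕ} (h : i ∈ x ↔ j ∈ x) :
    x ∈ shiftFam i j X ↔ x ∈ X := by
  rw [UV.mem_compression, compress_singleton, if_neg (by tauto)]
  constructor
  · rintro (⟨h1, -⟩ | ⟨h1, b, hb, h2⟩)
    · exact h1
    · rw [compress_singleton] at h2
      split_ifs at h2 with h3
      · have h4 : i ∈ x := h2 ▸ mem_insert_self i _
        have h5 : j ∉ x := by rw [← h2]; simp [Ne.symm h3.2.2]
        tauto
      · exact absurd (h2 ▸ hb) h1
  · exact fun h1 => Or.inl ⟨h1, h1⟩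

theorem shadow_shiftFam_subset (i j : ℕ) : ∂ (shiftFam i j X) ⊆ shiftFam i j (∂ X) := by
  refine UV.shadow_compression_subset_compression_shadow _ _ fun x hx => ⟨j, by simp, ?_⟩
  rw [mem_singleton] at hx
  subst hx
  simpa using UV.isCompressed_self ∅ X

theorem card_shadow_shiftFam_le (i j : ℕ) : #(∂ (shiftFam i j X)) ≤ #(∂ X) :=
  (card_le_card (shadow_shiftFam_subset i j)).trans (UV.card_compression _ _ _).le

theorem card_of_mem_shiftFam {i j : ℕ} (hX : ∀ x ∈ X, #x = m) : ∀ x ∈ shiftFam i j X, #x = m := by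
  have h : (X : Set (Finset ℕ)).Sized m := fun x hx => hX x hx
  exact fun x hx => h.uvCompression (u := {i}) (v := {j}) (by simp) hx

theorem image_map_shiftFam (σ : Equiv.Perm ℕ) (i j : ℕ) :
    (shiftFam i j X).image (map σ.toEmbedding) =
      shiftFam (σ i) (σ j) (X.image (map σ.toEmbedding)) := by
  have hc : ∀ x : Finset ℕ, UV.compress {σ i} {σ j} (x.map σ.toEmbedding) =
      (UV.compress {i} {j} x).map σ.toEmbedding := by
    intro x
    rw [compress_singleton, compress_singleton]
    simp only [mem_map_equiv, Equiv.symm_apply_apply, ne_eq, EmbeddingLike.apply_eq_iff_eq]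
    split_ifs
    · rw [map_insert, map_erase]; rfl
    · rfl
  have hinj := map_injective σ.toEmbedding
  ext y
  obtain ⟨x, rfl⟩ : ∃ x : Finset ℕ, x.map σ.toEmbedding = y :=
    ⟨y.map σ.symm.toEmbedding, by simp [map_map]⟩
  rw [hinj.mem_finset_image, UV.mem_compression, UV.mem_compression, hc, hinj.mem_finset_image,
    hinj.mem_finset_image]
  simp only [exists_mem_image, hc, hinj.eq_iff]

/-- The measure that makes repeated shifting terminate. -/
theorem sum_shiftFam_lt {i j : ℕ} (hij : i < j) {x : Finset ℕ} (hx : x ∈ X) (hjx : j ∈ x)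
    (hix : i ∉ x) (hnot : insert i (x.erase j) ∉ X) :
    ∑ y ∈ shiftFam i j X, ∑ e ∈ y, e < ∑ y ∈ X, ∑ e ∈ y, e := by
  have hc : ∀ y ∈ X.filter fun y => UV.compress {i} {j} y ∉ X,
      ∑ e ∈ UV.compress {i} {j} y, e < ∑ e ∈ y, e := by
    intro y hy
    obtain ⟨h1, h2⟩ := mem_filter.mp hy
    rw [compress_singleton] at h2 ⊢
    split_ifs at h2 ⊢ with h3
    · rw [sum_insert (by simp [h3.1]), ← add_sum_erase y (fun e => e) h3.2.1]
      exact Nat.add_lt_add_right hij _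
    · exact absurd h1 h2
  have hun : X.filter (fun y => UV.compress {i} {j} y ∈ X) ∪
      X.filter (fun y => UV.compress {i} {j} y ∉ X) = X := filter_union_filter_not_eq _ _
  unfold shiftFam UV.compression
  rw [sum_union UV.compress_disjoint]
  conv_rhs => rw [← hun]
  rw [sum_union (disjoint_filter_filter_not _ _ _), add_lt_add_iff_left, filter_image,
    sum_image UV.compress_injOn]
  refine sum_lt_sum_of_nonempty ⟨x, mem_filter.mpr ⟨hx, ?_⟩⟩ hc
  rwa [compress_singleton, if_pos ⟨hix, hjx, hij.ne⟩]

/-! ### Families whose shift is an initial segment -/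

/-- If the `μ`-maximal members of `F` and `F'` were distinct, one of them could be improved. -/
theorem exists_mem_inter {α β : Type*} [LinearOrder β] [DecidableEq α] {F F' : Finset α} (μ : α → β)
    (hF : F.Nonempty) (hF' : F'.Nonempty) (h : ∀ x ∈ F, ∀ y ∈ F', x ≠ y →
      (∃ z ∈ F, μ x < μ z) ∨ ∃ z ∈ F', μ y < μ z) : ∃ z, z ∈ F ∧ z ∈ F' := by
  obtain ⟨x, hx, hxmax⟩ := exists_max_image F μ hF
  obtain ⟨y, hy, hymax⟩ := exists_max_image F' μ hF'
  by_cases hxy : x = y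
  · exact ⟨x, hx, hxy ▸ hy⟩
  · obtain ⟨z, hz, hlt⟩ | ⟨z, hz, hlt⟩ := h x hx y hy hxy
    · exact absurd (hxmax z hz) hlt.not_ge
    · exact absurd (hymax z hz) hlt.not_ge

theorem sum_insert_erase {z : Finset ℕ} {e f : ℕ} (he : e ∈ z) (hf : f ∉ z) :
    ∑ a ∈ insert f (z.erase e), a + e = ∑ a ∈ z, a + f := by
  rw [sum_insert (by simp [hf]), ← add_sum_erase z (fun e => e) he]
  omega

variable {C : Finset (Finset ℕ)} {i j : ℕ}

/-- `z ∪ {i}` is in `C` and `z ∪ {j}` is not. -/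
def Split (C : Finset (Finset ℕ)) (i j : ℕ) (z : Finset ℕ) : Prop :=
  (i ∉ z ∧ j ∉ z) ∧ insert i z ∈ C ∧ insert j z ∉ C

theorem Split.card (hC : ∀ x ∈ C, #x = m + 1) {z : Finset ℕ} (hz : Split C i j z) : #z = m := by
  have := hC _ hz.2.1
  rw [card_insert_of_notMem hz.1.1] at this
  omega

theorem Split.lt (hC : ∀ x ∈ C, #x = m + 1) (hdown : DownClosed 0 C) {z w : Finset ℕ}
    (hz : Split C i j z) (hw : Split C i j w) : ColexLT (insert i z) (insert j w) := by
  have hcard : #(insert j w) = #(insert i z) := by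
    rw [card_insert_of_notMem hz.1.1, card_insert_of_notMem hw.1.2, hz.card hC, hw.card hC]
  obtain h | h | h := colexLT_trichotomy (insert i z) (insert j w)
  · exact h
  · exact absurd (h ▸ hz.2.1) hw.2.2
  · exact absurd (hdown _ hz.2.1 _ hcard (by simp) h) hw.2.2

/-- `insert i z` precedes `insert j w`, and `insert i w` precedes `insert j z`. A difference above
`j` would decide the two comparisons in opposite ways. -/
theorem Split.mem_iff (hC : ∀ x ∈ C, #x = m + 1) (hdown : DownClosed 0 C) (hij : i < j)
    {z w : Finset ℕ} (hz : Split C i j z) (hw : Split C i j w) {a : ℕ} (ha : j < a) :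
    a ∈ z ↔ a ∈ w := by
  obtain ⟨k, hk1, hk2, hk⟩ := hz.lt hC hdown hw
  obtain ⟨k', hk1', hk2', hk'⟩ := hw.lt hC hdown hz
  simp only [mem_insert, not_or] at *
  rcases Nat.lt_or_ge k a with h1 | h1
  · have := hk a h1
    simpa [show a ≠ i by omega, show a ≠ j by omega] using this
  rcases Nat.lt_or_ge k' a with h2 | h2
  · have := hk' a h2
    simpa [show a ≠ i by omega, show a ≠ j by omega] using this.symm
  exfalso
  have h3 : k ∈ w := hk1.resolve_left (by omega)
  have h4 : k' ∈ z := hk1'.resolve_left (by omega)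
  rcases lt_trichotomy k k' with h5 | h5 | h5
  · have := hk k' h5
    exact hk2'.2 ((this.mp (Or.inr h4)).resolve_left (by omega))
  · exact hk2.2 (h5 ▸ h4)
  · have := hk' k h5
    exact hk2.2 ((this.mp (Or.inr h3)).resolve_left (by omega))

/-- Two sets of splitting sets that are closed under exchanges of an element in which the
common part is not in the shadow meet. -/
theorem exists_mem_inter_of_split (hC : ∀ x ∈ C, #x = m + 1) (hdown : DownClosed 0 C)
    (hclosed : ∀ x : Finset ℕ, #x = m + 1 → ∀ e ∈ x, (∀ a ∈ x, e ≤ a) → x.erase e ∈ ∂ C → x ∈ C)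
    (hij : i < j) {F F' : Finset (Finset ℕ)} (hFn : F.Nonempty) (hFn' : F'.Nonempty)
    (hFs : ∀ z ∈ F, Split C i j z) (hFs' : ∀ z ∈ F', Split C i j z)
    (hF : ∀ z ∈ F, ∀ e ∈ z, ∀ a, a ∉ z → Split C i j (insert a (z.erase e)) →
      insert j (z.erase e) ∉ ∂ C → insert a (z.erase e) ∈ F)
    (hF' : ∀ z ∈ F', ∀ e ∈ z, ∀ a, a ∉ z → Split C i j (insert a (z.erase e)) →
      insert j (z.erase e) ∉ ∂ C → insert a (z.erase e) ∈ F') :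
    ∃ z, z ∈ F ∧ z ∈ F' := by
  -- elements that distinguish two splitting sets
  have diff : ∀ z w, Split C i j z → Split C i j w → z ≠ w → ∃ a ∈ w, a ∉ z ∧ a < j ∧ a ≠ i := by
    intro z w hz hw hne
    obtain ⟨a, haw, haz⟩ : ∃ a ∈ w, a ∉ z := by
      by_contra! hsub
      exact hne (eq_of_subset_of_card_le hsub (by rw [hz.card hC, hw.card hC])).symm
    refine ⟨a, haw, haz, ?_, by rintro rfl; exact hw.1.1 haw⟩
    by_contra! hja
    rcases hja.eq_or_lt with rfl | hja
    · exact hw.1.2 haw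
    · exact haz ((hz.mem_iff hC hdown hij hw hja).mpr haw)
  -- the new splitting sets
  have hsplit : ∀ z, Split C i j z → ∀ e ∈ z, ∀ a, a ∉ z → a < j → a ≠ i →
      insert i (insert a (z.erase e)) ∈ C → insert j (z.erase e) ∉ ∂ C →
      Split C i j (insert a (z.erase e)) := by
    intro z hz e he a ha haj hai h1 h2
    refine ⟨⟨?_, ?_⟩, h1, fun h3 => h2 (mem_shadow_iff_insert_mem.mpr ⟨a, ?_, ?_⟩)⟩
    · simp [Ne.symm hai, hz.1.1]
    · simp [haj.ne', hz.1.2]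
    · simp [ha, haj.ne]
    · rwa [Finset.insert_comm]
  obtain ⟨u, hu⟩ := hFn
  have hus := hFs u hu
  -- If every candidate `insert i z` is in `C`, elements of splitting sets can be raised. If one,
  -- `insert i v`, is missing, they are lowered instead, and down-closedness keeps `insert i z` in
  -- `C`.
  by_cases hall : ∀ z : Finset ℕ, i ∉ z → j ∉ z → #z = m → (∀ a, j < a → (a ∈ z ↔ a ∈ u)) →
      insert i z ∈ C
  · have hraise : ∀ z, Split C i j z → ∀ e ∈ z, (∀ b ∈ z, e ≤ b) → e < j → ∀ a, a ∉ z → a < j →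
        a ≠ i → Split C i j (insert a (z.erase e)) ∧ insert j (z.erase e) ∉ ∂ C := by
      intro z hz e he hmin hej a ha haj hai
      have h1 : insert j (z.erase e) ∉ ∂ C := by
        intro h1
        refine hz.2.2 (hclosed _ ?_ e (by simp [he]) ?_ ?_)
        · rw [card_insert_of_notMem hz.1.2, hz.card hC]
        · simpa [hej.le] using hmin
        · rwa [erase_insert_of_ne hej.ne']
      refine ⟨hsplit z hz e he a ha haj hai (hall _ ?_ ?_ ?_ fun b hb => ?_) h1, h1⟩
      · simp [Ne.symm hai, hz.1.1]
      · simp [haj.ne', hz.1.2]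
      · rw [card_insert_of_notMem (by simp [ha]), card_erase_add_one he, hz.card hC]
      · rw [← hz.mem_iff hC hdown hij hus hb, mem_insert, mem_erase]
        constructor
        · rintro (h2 | h2)
          · omega
          · exact h2.2
        · intro h2; exact Or.inr ⟨by omega, h2⟩
    have hmin : ∀ z : Finset ℕ, ∀ a ∈ z, ∃ e ∈ z, (∀ b ∈ z, e ≤ b) ∧ e ≤ a := fun z a ha =>
      ⟨z.min' ⟨a, ha⟩, min'_mem _ _, fun b hb => min'_le _ _ hb, min'_le _ _ ha⟩
    refine exists_mem_inter (fun z : Finset ℕ => ∑ a ∈ z, a) ⟨u, hu⟩ hFn' fun z hz w hw hne => ?_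
    have hzs := hFs z hz
    have hws := hFs' w hw
    obtain ⟨a, haw, haz, haj, hai⟩ := diff z w hzs hws hne
    obtain ⟨b, hbz, hbw, hbj, hbi⟩ := diff w z hws hzs hne.symm
    obtain ⟨e, he, hemin, heb⟩ := hmin z b hbz
    obtain ⟨e', he', hemin', hea⟩ := hmin w a haw
    -- The set with the smaller minimum trades it for an element of the other set, which increases
    -- the sum.
    rcases Nat.le_total e e' with hee | hee
    · left
      obtain ⟨h1, h2⟩ := hraise z hzs e he hemin (by omega) a haz haj hai
      refine ⟨_, hF z hz e he a haz h1 h2, ?_⟩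
      have := sum_insert_erase he haz
      have : e ≠ a := by rintro rfl; exact haz he
      omega
    · right
      obtain ⟨h1, h2⟩ := hraise w hws e' he' hemin' (by omega) b hbw hbj hbi
      refine ⟨_, hF' w hw e' he' b hbw h1 h2, ?_⟩
      have := sum_insert_erase he' hbw
      have : e' ≠ b := by rintro rfl; exact hbw he'
      omega
  · push Not at hall
    obtain ⟨v, hiv, hjv, hvm, hvu, hvC⟩ := hall
    have hlower : ∀ z, Split C i j z → ∀ e ∈ z, e < j → ∀ a, a ∉ z → a < e →
        a ≠ i → Split C i j (insert a (z.erase e)) ∧ insert j (z.erase e) ∉ ∂ C := by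
      intro z hz e he hej a ha hae hai
      have h1 : insert j (z.erase e) ∉ ∂ C := by
        -- A set of `C` containing `insert j (z.erase e)` would come after `insert i v`, which is
        -- not in `C`.
        intro h1
        obtain ⟨b, hb, hbC⟩ := mem_shadow_iff_insert_mem.mp h1
        simp only [mem_insert, mem_erase, not_or, not_and] at hb
        refine hvC (hdown _ hbC _ ?_ (by simp) ?_)
        · rw [hC _ hbC, card_insert_of_notMem hiv, hvm]
        have hvz : ∀ c, j < c → (c ∈ v ↔ c ∈ z) := fun c hc =>
          (hvu c hc).trans (hz.mem_iff hC hdown hij hus hc).symm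
        rcases lt_or_gt_of_ne hb.1 with hbj | hbj
        · refine ⟨j, by simp, by simp [hjv, hij.ne'], fun c hc => ?_⟩
          simp only [mem_insert, mem_erase, hvz c hc, show c ≠ i by omega, show c ≠ b by omega,
            show c ≠ j by omega, show c ≠ e by omega, false_or, ne_eq, not_false_eq_true, true_and]
        · have hbz : b ∉ z := hb.2 (by omega)
          refine ⟨b, by simp, ?_, fun c hc => ?_⟩
          · rw [mem_insert, hvz b hbj]
            simp [hbz]; omega
          · simp only [mem_insert, mem_erase, hvz c (by omega), show c ≠ i by omega,
              show c ≠ b by omega, show c ≠ j by omega, show c ≠ e by omega, false_or, ne_eq,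
              not_false_eq_true, true_and]
      refine ⟨hsplit z hz e he a ha (by omega) hai ?_ h1, h1⟩
      have hei : e ≠ i := by rintro rfl; exact hz.1.1 he
      refine hdown _ hz.2.1 _ ?_ (by simp) ⟨e, by simp [he], by simp [hei, hae.ne'], fun c hc => ?_⟩
      · rw [card_insert_of_notMem, card_insert_of_notMem (by simp [ha]), card_erase_add_one he,
          card_insert_of_notMem hz.1.1]
        simp [Ne.symm hai, hz.1.1]
      · simp only [mem_insert, mem_erase, show c ≠ a by omega, show c ≠ e by omega, false_or, ne_eq,
          not_false_eq_true, true_and]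
    refine exists_mem_inter (fun z : Finset ℕ => -((∑ a ∈ z, a : ℕ) : ℤ)) ⟨u, hu⟩ hFn'
      fun z hz w hw hne => ?_
    have hzs := hFs z hz
    have hws := hFs' w hw
    obtain ⟨a, haw, haz, haj, hai⟩ := diff z w hzs hws hne
    obtain ⟨b, hbz, hbw, hbj, hbi⟩ := diff w z hws hzs hne.symm
    rcases lt_trichotomy a b with hab | rfl | hab
    · left
      obtain ⟨h1, h2⟩ := hlower z hzs b hbz hbj a haz hab hai
      refine ⟨_, hF z hz b hbz a haz h1 h2, ?_⟩
      have := sum_insert_erase hbz haz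
      omega
    · exact absurd haw hbw
    · right
      obtain ⟨h1, h2⟩ := hlower w hws a haw haj b hbw hab hbi
      refine ⟨_, hF' w hw a haw b hbw h1 h2, ?_⟩
      have := sum_insert_erase haw hbw
      omega

/-- If the shift of `Y` is an initial segment `C` that is determined by its shadow, and the shadow
has not become smaller, then the shift does nothing, or it exchanges `i` and `j`. -/
theorem eq_or_image_swap_eq {Y : Finset (Finset ℕ)} (hC : ∀ x ∈ C, #x = m + 1)
    (hdown : DownClosed 0 C)
    (hclosed : ∀ x : Finset ℕ, #x = m + 1 → ∀ e ∈ x, (∀ a ∈ x, e ≤ a) → x.erase e ∈ ∂ C → x ∈ C)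
    (hij : i ≠ j) (hY : shiftFam i j Y = C) (hsh : #(∂ Y) ≤ #(∂ C)) :
    Y = C ∨ Y.image (map (Equiv.swap i j).toEmbedding) = C := by
  have hYsh : ∂ C = shiftFam i j (∂ Y) := by
    refine eq_of_subset_of_card_le (hY ▸ shadow_shiftFam_subset i j) ?_
    rwa [UV.card_compression]
  have hl : ∀ z : Finset ℕ, i ∉ z → j ∉ z → (insert i z ∈ C ↔ insert i z ∈ Y ∨ insert j z ∈ Y) :=
    fun z hi hj => hY ▸ insert_left_mem_shiftFam hij hi hj
  have hr : ∀ z : Finset ℕ, i ∉ z → j ∉ z → (insert j z ∈ C ↔ insert i z ∈ Y ∧ insert j z ∈ Y) :=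
    fun z hi hj => hY ▸ insert_right_mem_shiftFam hij hi hj
  have he : ∀ x : Finset ℕ, (i ∈ x ↔ j ∈ x) → (x ∈ C ↔ x ∈ Y) :=
    fun x hx => hY ▸ mem_shiftFam_of_iff hx
  set F := (Y.memberSubfamily i).filter fun z => j ∉ z ∧ insert j z ∉ Y with hF
  set F' := (Y.memberSubfamily j).filter fun z => i ∉ z ∧ insert i z ∉ Y with hF'
  have memF : ∀ z, z ∈ F ↔ (i ∉ z ∧ j ∉ z) ∧ insert i z ∈ Y ∧ insert j z ∉ Y := by
    intro z
    rw [hF, mem_filter, mem_memberSubfamily]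
    tauto
  have memF' : ∀ z, z ∈ F' ↔ (i ∉ z ∧ j ∉ z) ∧ insert j z ∈ Y ∧ insert i z ∉ Y := by
    intro z
    rw [hF', mem_filter, mem_memberSubfamily]
    tauto
  by_cases h1 : F'.Nonempty
  · by_cases h2 : F.Nonempty
    · exfalso
      have hFs : ∀ z ∈ F, Split C i j z := by
        intro z hz
        rw [memF] at hz
        exact ⟨hz.1, (hl z hz.1.1 hz.1.2).mpr (Or.inl hz.2.1),
          fun h => hz.2.2 ((hr z hz.1.1 hz.1.2).mp h).2⟩
      have hFs' : ∀ z ∈ F', Split C i j z := by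
        intro z hz
        rw [memF'] at hz
        exact ⟨hz.1, (hl z hz.1.1 hz.1.2).mpr (Or.inr hz.2.1),
          fun h => hz.2.2 ((hr z hz.1.1 hz.1.2).mp h).1⟩
      rcases lt_or_gt_of_ne hij with hlt | hlt
      -- By `hYsh`, if `insert j w ∉ ∂ C`, then `insert i w` and `insert j w` are not both in `∂ Y`.
      -- This prevents an exchange from moving between `F` and `F'`.
      · have hno : ∀ w : Finset ℕ, i ∉ w → j ∉ w → insert j w ∉ ∂ C → ∀ a b, a ∉ w → a ≠ i →
            b ∉ w → b ≠ j → insert i (insert a w) ∈ Y → insert j (insert b w) ∉ Y := by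
          intro w hi hj hw a b ha hai hb hbj h3 h4
          rw [hYsh, insert_right_mem_shiftFam hij hi hj] at hw
          refine hw ⟨mem_shadow_iff_insert_mem.mpr ⟨a, by simp [ha, hai], ?_⟩,
            mem_shadow_iff_insert_mem.mpr ⟨b, by simp [hb, hbj], ?_⟩⟩
          · rwa [Finset.insert_comm]
          · rwa [Finset.insert_comm]
        obtain ⟨z, hz, hz'⟩ := exists_mem_inter_of_split hC hdown hclosed hlt h2 h1 hFs hFs'
          (by
            intro z hz e hez a haz hs hsh
            rw [memF] at hz ⊢
            have hai : a ≠ i := by rintro rfl; exact hs.1.1 (mem_insert_self _ _)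
            have haj : a ≠ j := by rintro rfl; exact hs.1.2 (mem_insert_self _ _)
            have h3 := hno (z.erase e) (by simp [hz.1.1]) (by simp [hz.1.2]) hsh e a (by simp)
              (by rintro rfl; exact hz.1.1 hez) (by simp [haz]) haj (by
                rw [insert_erase hez]; exact hz.2.1)
            exact ⟨hs.1, ((hl _ hs.1.1 hs.1.2).mp hs.2.1).resolve_right h3, h3⟩)
          (by
            intro z hz e hez a haz hs hsh
            rw [memF'] at hz ⊢
            have hai : a ≠ i := by rintro rfl; exact hs.1.1 (mem_insert_self _ _)
            have haj : a ≠ j := by rintro rfl; exact hs.1.2 (mem_insert_self _ _)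
            have h3 : insert i (insert a (z.erase e)) ∉ Y := fun h4 =>
              hno (z.erase e) (by simp [hz.1.1]) (by simp [hz.1.2]) hsh a e (by simp [haz]) hai
                (by simp) (by rintro rfl; exact hz.1.2 hez) h4
                (by rw [insert_erase hez]; exact hz.2.1)
            exact ⟨hs.1, ((hl _ hs.1.1 hs.1.2).mp hs.2.1).resolve_left h3, h3⟩)
        exact ((memF z).mp hz).2.2 ((memF' z).mp hz').2.1
      -- For `j < i` no set splits, as `insert j z` precedes `insert i z`. This order can occur
      -- because the points are images under an arbitrary permutation.
      · obtain ⟨z, hz⟩ := h2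
        have hs := hFs z hz
        refine hs.2.2 (hdown _ hs.2.1 _ ?_ (by simp) ⟨i, by simp, ?_, fun a ha => ?_⟩)
        · rw [card_insert_of_notMem hs.1.1, card_insert_of_notMem hs.1.2]
        · simp [hij, hs.1.1]
        · simp only [mem_insert, show a ≠ i by omega, show a ≠ j by omega, false_or]
    · right
      have hsub : ∀ z : Finset ℕ, i ∉ z → j ∉ z → insert i z ∈ Y → insert j z ∈ Y := by
        intro z hi hj h3
        by_contra h4
        exact h2 ⟨z, (memF z).mpr ⟨⟨hi, hj⟩, h3, h4⟩⟩
      ext y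
      obtain ⟨x, rfl⟩ : ∃ x : Finset ℕ, x.map (Equiv.swap i j).toEmbedding = y :=
        ⟨y.map (Equiv.swap i j).symm.toEmbedding, by ext a; simp only [mem_map_equiv, Equiv.symm_symm, Equiv.apply_symm_apply]⟩
      rw [(map_injective _).mem_finset_image]
      have hfix : ∀ z : Finset ℕ, i ∉ z → j ∉ z → z.map (Equiv.swap i j).toEmbedding = z := by
        intro z hi hj
        rw [map_eq_image]
        refine (image_congr fun a ha => ?_).trans image_id
        exact Equiv.swap_apply_of_ne_of_ne (by rintro rfl; exact hi ha) (by rintro rfl; exact hj ha)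
      by_cases hix : i ∈ x <;> by_cases hjx : j ∈ x
      · obtain ⟨z, hi, hj, rfl⟩ : ∃ z, i ∉ z ∧ j ∉ z ∧ insert i (insert j z) = x :=
          ⟨(x.erase i).erase j, by simp, by simp, by
            rw [insert_erase (by simp [hjx, hij.symm]), insert_erase hix]⟩
        rw [map_insert, map_insert, hfix z hi hj]
        simp only [Equiv.coe_toEmbedding, Equiv.swap_apply_left, Equiv.swap_apply_right]
        rw [Finset.insert_comm j i]
        exact (he _ (by simp)).symm
      · obtain ⟨z, hi, hj, rfl⟩ : ∃ z, i ∉ z ∧ j ∉ z ∧ insert i z = x :=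
          ⟨x.erase i, by simp, by simp [hjx], insert_erase hix⟩
        rw [map_insert, hfix z hi hj]
        simp only [Equiv.coe_toEmbedding, Equiv.swap_apply_left]
        rw [hr z hi hj]
        exact ⟨fun h => ⟨h, hsub z hi hj h⟩, fun h => h.1⟩
      · obtain ⟨z, hi, hj, rfl⟩ : ∃ z, i ∉ z ∧ j ∉ z ∧ insert j z = x :=
          ⟨x.erase j, by simp [hix], by simp, insert_erase hjx⟩
        rw [map_insert, hfix z hi hj]
        simp only [Equiv.coe_toEmbedding, Equiv.swap_apply_right]
        rw [hl z hi hj]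
        exact ⟨Or.inr, fun h => h.elim (hsub z hi hj) id⟩
      · rw [hfix x hix hjx]
        exact (he x (by tauto)).symm
  · left
    have hsub : ∀ z : Finset ℕ, i ∉ z → j ∉ z → insert j z ∈ Y → insert i z ∈ Y := by
      intro z hi hj h3
      by_contra h4
      exact h1 ⟨z, (memF' z).mpr ⟨⟨hi, hj⟩, h3, h4⟩⟩
    ext x
    by_cases hix : i ∈ x <;> by_cases hjx : j ∈ x
    · exact (he x (by tauto)).symm
    · obtain ⟨z, hi, hj, rfl⟩ : ∃ z, i ∉ z ∧ j ∉ z ∧ insert i z = x :=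
        ⟨x.erase i, by simp, by simp [hjx], insert_erase hix⟩
      rw [hl z hi hj]
      exact ⟨Or.inl, fun h => h.elim id (hsub z hi hj)⟩
    · obtain ⟨z, hi, hj, rfl⟩ : ∃ z, i ∉ z ∧ j ∉ z ∧ insert j z = x :=
        ⟨x.erase j, by simp [hix], by simp, insert_erase hjx⟩
      rw [hr z hi hj]
      exact ⟨fun h => ⟨hsub z hi hj h, h⟩, fun h => h.2⟩
    · exact (he x (by tauto)).symm

/-! ### Uniqueness of the families with minimum shadow -/

theorem DownClosed.eq_of_card_eq (hX : ∀ x ∈ X, #x = m) (hC : ∀ x ∈ C, #x = m)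
    (h : DownClosed 0 X) (h' : DownClosed 0 C) (hcard : #X = #C) : X = C := by
  by_contra hne
  obtain ⟨x, hx, hxC⟩ : ∃ x ∈ X, x ∉ C := by
    by_contra! hsub
    exact hne (eq_of_subset_of_card_le hsub hcard.ge)
  refine hne (eq_of_subset_of_card_le (fun y hy => ?_) hcard.le).symm
  obtain hlt | rfl | hlt := colexLT_trichotomy x y
  · exact absurd (h' y hy x (by rw [hX x hx, hC y hy]) (by simp) hlt) hxC
  · exact hx
  · exact h x hx y (by rw [hX x hx, hC y hy]) (by simp) hlt

/-- **Uniqueness in the Kruskal–Katona theorem**: if the cascade is not full, then a family of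
`m`-sets with minimum shadow is an initial segment of the colex order, up to a permutation. -/
theorem exists_perm_image_eq (hX : ∀ x ∈ X, #x = m) (hl : Dec l) (hnd : Nondeg m l)
    (hlen : l.length < m) (hcard : #X = cas m l) (hsh : #(∂ X) ≤ casShadow m l) :
    ∃ σ : Equiv.Perm ℕ, X.image (map σ.toEmbedding) = casc m l := by
  have hC : ∀ x ∈ casc m l, #x = m := fun x hx => card_of_mem_casc hl hx
  have hdown := downClosed_casc (m := m) hl
  induction hN : ∑ y ∈ X, ∑ e ∈ y, e using Nat.strong_induction_on generalizing X with
  | _ N ih =>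
    by_cases hs : Shifted 0 X
    · refine ⟨1, ?_⟩
      rw [← (hs.downClosed hX hl hnd hlen hcard hsh).eq_of_card_eq hX hC hdown
        (hcard.trans (card_casc hl).symm)]
      exact (image_congr fun x _ => map_refl).trans image_id
    · obtain ⟨x, hx, i, j, hij, hjx, hix, hnot⟩ : ∃ x ∈ X, ∃ i j, i < j ∧ j ∈ x ∧ i ∉ x ∧
          insert i (x.erase j) ∉ X := by
        by_contra! hcon
        exact hs ⟨by simp, fun x hx i j _ hij hjx hix => hcon x hx i j hij hjx hix⟩
      obtain ⟨σ, hσ⟩ := ih _ (hN ▸ sum_shiftFam_lt hij hx hjx hix hnot)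
        (card_of_mem_shiftFam hX) ((UV.card_compression _ _ _).trans hcard)
        ((card_shadow_shiftFam_le i j).trans hsh) rfl
      obtain ⟨m, rfl⟩ : ∃ m', m = m' + 1 := ⟨m - 1, by omega⟩
      rw [image_map_shiftFam] at hσ
      -- Removing the minimum leaves the colex-largest of the sets `x.erase e`, and the shadow of an
      -- initial segment is one as well; so this single membership implies all the others.
      have hclosed : ∀ x : Finset ℕ, #x = m + 1 → ∀ e ∈ x, (∀ a ∈ x, e ≤ a) →
          x.erase e ∈ ∂ (casc (m + 1) l) → x ∈ casc (m + 1) l := by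
        intro x hx e he hmin hsh
        refine mem_of_erase_mem_shadow hC hl hnd hlen (card_casc hl) (card_shadow_casc hl hnd).le hx
          fun a ha => ?_
        refine (hdown.shadow hC (by simp)).mem_of_le hsh ?_ (by simp) ?_
        · rw [card_erase_of_mem ha, card_erase_of_mem he]
        · have := Finset.Colex.erase_le_erase_min' (le_refl (toColex x)) le_rfl ha
          convert this using 3
          exact le_antisymm (hmin _ (min'_mem _ _)) (min'_le _ _ he)
      obtain h | h := eq_or_image_swap_eq hC hdown hclosed (σ.injective.ne hij.ne) hσ (by
        rw [shadow_image_map, card_image_map, card_shadow_casc hl hnd]; exact hsh)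
      · exact ⟨σ, h⟩
      · refine ⟨σ.trans (Equiv.swap (σ i) (σ j)), ?_⟩
        rw [← h, image_image]
        refine image_congr fun x _ => ?_
        simp [map_map]

end JohnsonIso.Cascade

namespace JohnsonIso.Cascade

open Finset
open scoped FinsetFamily

/-! ### Sizes of shadows -/

theorem card_shadow_le {α : Type*} [DecidableEq α] {p : ℕ} {F : Finset (Finset α)}
    (hF : ∀ s ∈ F, #s = p) : #(∂ F) ≤ #F * p := by
  rw [shadow, sup_eq_biUnion]
  exact card_biUnion_le_card_mul _ _ _ fun s hs => card_image_le.trans (hF s hs).le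

section UpShadow

variable {α : Type*} [Fintype α] [DecidableEq α] {p : ℕ} {F : Finset (Finset α)}

theorem upShadow_insert (s : Finset α) (F : Finset (Finset α)) :
    ∂⁺ (insert s F) = sᶜ.image (fun a => insert a s) ∪ ∂⁺ F := by
  rw [upShadow, upShadow, sup_insert, sup_eq_union]

theorem card_image_insert_compl (s : Finset α) :
    #(sᶜ.image fun a => insert a s) = Fintype.card α - #s := by
  rw [card_image_of_injOn, card_compl]
  intro a ha b hb hab
  exact (insert_inj (by simpa using ha)).mp hab

theorem card_upShadow_le (hF : ∀ s ∈ F, #s = p) : #(∂⁺ F) ≤ #F * (Fintype.card α - p) := by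
  rw [upShadow, sup_eq_biUnion]
  refine card_biUnion_le_card_mul _ _ _ fun s hs => ?_
  rw [card_image_insert_compl, hF s hs]

/-- When a set `s` is added, an overlap with the upper shadow of an earlier `z` can only be `s ∪ z`;
so each earlier set costs at most one. -/
theorem le_card_upShadow (hF : ∀ s ∈ F, #s = p) :
    #F * (Fintype.card α - p) ≤ #(∂⁺ F) + #F ^ 2 := by
  induction F using Finset.induction_on with
  | empty => simp
  | insert s F hs ih =>
    have h1 := ih fun t ht => hF t (mem_insert_of_mem ht)
    have h2 : #((sᶜ.image fun a => insert a s) ∩ ∂⁺ F) ≤ #F := by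
      refine (card_le_card fun y hy => ?_).trans (card_image_le (f := fun z => s ∪ z))
      obtain ⟨hy1, hy2⟩ := mem_inter.mp hy
      obtain ⟨a, ha, rfl⟩ := mem_image.mp hy1
      obtain ⟨z, hz, b, hb, hab⟩ := mem_upShadow_iff.mp hy2
      refine mem_image.mpr ⟨z, hz, ?_⟩
      have ha : a ∉ s := by simpa using ha
      have hcard : #z = #s := by
        rw [hF z (mem_insert_of_mem hz), hF s (mem_insert_self _ _)]
      refine eq_of_subset_of_card_le
        (union_subset (subset_insert _ _) (hab ▸ subset_insert _ _)) ?_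
      rw [card_insert_of_notMem ha]
      by_contra! hlt
      have h3 : s = s ∪ z := eq_of_subset_of_card_le subset_union_left (by omega)
      have h4 : z = s ∪ z := eq_of_subset_of_card_le subset_union_right (by omega)
      exact hs (by rwa [h3, ← h4])
    have h3 := card_union_add_card_inter (sᶜ.image fun a => insert a s) (∂⁺ F)
    rw [card_image_insert_compl, hF s (mem_insert_self _ _)] at h3
    rw [upShadow_insert, card_insert_of_notMem hs]
    nlinarith

end UpShadow

/-! ### Boundaries in the Johnson graph -/

variable {n m k : ℕ}

theorem johnsonGraph_adj_iff {s t : Vertex n m} : (johnsonGraph n m).Adj s t ↔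
    ∃ e ∈ s.1, ∃ b ∉ s.1, insert b (s.1.erase e) = t.1 := by
  obtain ⟨s, hs⟩ := s
  obtain ⟨t, ht⟩ := t
  change #(symmDiff s t) = 2 ↔ _
  dsimp only
  constructor
  · intro h
    rw [symmDiff_def, sup_eq_union, card_union_of_disjoint disjoint_sdiff_sdiff] at h
    have h1 := card_sdiff_add_card_inter s t
    have h2 := card_sdiff_add_card_inter t s
    rw [inter_comm] at h2
    obtain ⟨e, he⟩ := card_eq_one.mp (show #(s \ t) = 1 by omega)
    obtain ⟨b, hb⟩ := card_eq_one.mp (show #(t \ s) = 1 by omega)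
    simp only [Finset.ext_iff, mem_sdiff, mem_singleton] at he hb
    refine ⟨e, ((he e).mpr rfl).1, b, ((hb b).mpr rfl).2, ?_⟩
    ext a
    have := he a
    have := hb a
    rw [mem_insert, mem_erase]
    tauto
  · rintro ⟨e, he, b, hb, rfl⟩
    have hbe : e ≠ b := by rintro rfl; exact hb he
    rw [← card_pair hbe]
    congr 1
    ext a
    simp only [mem_symmDiff, mem_insert, mem_erase, mem_singleton]
    by_cases h1 : a = e
    · subst h1; simp [he, hbe]
    · by_cases h2 : a = b
      · subst h2; simp [hb, h1]
      · simp [h1, h2]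

theorem mem_boundary {V : Type*} [Fintype V] {G : SimpleGraph V} {X : Finset V} {y : V} :
    y ∈ boundary G X ↔ y ∉ X ∧ ∃ x ∈ X, G.Adj x y := by
  simp [boundary]

/-- A set of vertices of the Johnson graph as a family of subsets of `Fin n`. -/
def finFam (S : Finset (Vertex n m)) : Finset (Finset (Fin n)) :=
  S.map (Function.Embedding.subtype _)

theorem mem_finFam {S : Finset (Vertex n m)} {x : Finset (Fin n)} :
    x ∈ finFam S ↔ ∃ h : #x = m, ⟨x, h⟩ ∈ S := by
  simp [finFam]

theorem card_finFam (S : Finset (Vertex n m)) : #(finFam S) = #S := card_map _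

theorem finFam_injective : Function.Injective (finFam (n := n) (m := m)) := map_injective _

theorem card_of_mem_finFam {S : Finset (Vertex n m)} {x : Finset (Fin n)} (hx : x ∈ finFam S) :
    #x = m := (mem_finFam.mp hx).1

/-- Removing a point and adding one back either restores the set or moves to a neighbour. -/
theorem upShadow_shadow_finFam (hm : 0 < m) (S : Finset (Vertex n m)) :
    ∂⁺ (∂ (finFam S)) = finFam (S ∪ boundary (johnsonGraph n m) S) := by
  ext y
  simp only [mem_upShadow_iff, mem_shadow_iff, mem_finFam, mem_union, mem_boundary,
    johnsonGraph_adj_iff]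
  constructor
  · rintro ⟨_, ⟨x, ⟨hx, hxS⟩, e, he, rfl⟩, b, hb, rfl⟩
    refine ⟨by rw [card_insert_of_notMem hb, card_erase_of_mem he]; omega, ?_⟩
    by_cases hbe : b = e
    · subst hbe
      left
      simpa only [insert_erase he] using hxS
    · by_cases hS : (⟨insert b (x.erase e), by
        rw [card_insert_of_notMem hb, card_erase_of_mem he]; omega⟩ : Vertex n m) ∈ S
      · exact Or.inl hS
      · exact Or.inr ⟨hS, ⟨x, hx⟩, hxS, e, he, b, fun h => hb (by simp [hbe, h]), rfl⟩
  · rintro ⟨hy, hS | ⟨-, x, hxS, e, he, b, hb, hxy⟩⟩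
    · obtain ⟨e, he⟩ := card_pos.mp (hy.symm ▸ hm)
      exact ⟨y.erase e, ⟨y, ⟨hy, hS⟩, e, he, rfl⟩, e, by simp, insert_erase he⟩
    · exact ⟨x.1.erase e, ⟨x.1, ⟨x.2, hxS⟩, e, he, rfl⟩, b, by simp [hb], hxy⟩

theorem card_boundary_add_card (hm : 0 < m) (S : Finset (Vertex n m)) :
    #(boundary (johnsonGraph n m) S) + #S = #(∂⁺ (∂ (finFam S))) := by
  rw [upShadow_shadow_finFam hm, card_finFam, card_union_of_disjoint, add_comm]
  rw [disjoint_left]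
  intro x hx hx'
  exact (mem_boundary.mp hx').1 hx

theorem card_of_mem_shadow_finFam {S : Finset (Vertex n m)} {x : Finset (Fin n)}
    (hx : x ∈ ∂ (finFam S)) : #x = m - 1 := by
  obtain ⟨y, hy, e, he, rfl⟩ := mem_shadow_iff.mp hx
  rw [card_erase_of_mem he, card_of_mem_finFam hy]

theorem card_boundary_add_card_le (hm : 0 < m) (S : Finset (Vertex n m)) :
    #(boundary (johnsonGraph n m) S) + #S ≤ #(∂ (finFam S)) * (n - (m - 1)) := by
  rw [card_boundary_add_card hm]
  simpa using card_upShadow_le (F := ∂ (finFam S)) fun _ h => card_of_mem_shadow_finFam h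

/-- The error term is the square of the bound `#S * m` for the size of the shadow. -/
theorem card_shadow_mul_le (hm : 0 < m) (S : Finset (Vertex n m)) :
    #(∂ (finFam S)) * (n - (m - 1)) ≤
      #(boundary (johnsonGraph n m) S) + #S + (#S * m) ^ 2 := by
  rw [card_boundary_add_card hm]
  have h1 := le_card_upShadow (F := ∂ (finFam S)) fun _ h => card_of_mem_shadow_finFam h
  have h2 := card_shadow_le (F := finFam S) fun _ h => card_of_mem_finFam h
  rw [card_finFam] at h2
  rw [Fintype.card_fin] at h1
  exact h1.trans (Nat.add_le_add_left (Nat.pow_le_pow_left h2 2) _)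

/-- A larger shadow means a larger boundary, if `n` is large. -/
theorem card_boundary_lt {S T : Finset (Vertex n m)} (hm : 0 < m) (hST : #S = #T)
    (hn : m + (#S * m) ^ 2 ≤ n) (h : #(∂ (finFam S)) < #(∂ (finFam T))) :
    #(boundary (johnsonGraph n m) S) < #(boundary (johnsonGraph n m) T) := by
  have h1 := card_boundary_add_card_le hm S
  have h2 := card_shadow_mul_le hm T
  rw [← hST] at h2
  have h3 := Nat.mul_le_mul_right (n - (m - 1)) (Nat.succ_le_of_lt h)
  rw [Nat.succ_mul] at h3
  omega

/-! ### Families of sets of natural numbers -/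

/-- A set of vertices of the Johnson graph as a family of sets of natural numbers. -/
def natFam (S : Finset (Vertex n m)) : Finset (Finset ℕ) := (finFam S).image (map Fin.valEmbedding)

theorem card_natFam (S : Finset (Vertex n m)) : #(natFam S) = #S := by
  rw [natFam, card_image_map, card_finFam]

theorem card_shadow_natFam (S : Finset (Vertex n m)) : #(∂ (natFam S)) = #(∂ (finFam S)) := by
  rw [natFam, shadow_image_map, card_image_map]

theorem natFam_injective : Function.Injective (natFam (n := n) (m := m)) :=
  fun _ _ h => finFam_injective (image_injective (map_injective _) h)

theorem mem_natFam {S : Finset (Vertex n m)} {x : Finset ℕ} :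
    x ∈ natFam S ↔ ∃ s ∈ S, s.1.map Fin.valEmbedding = x := by
  simp [natFam, finFam]

theorem card_of_mem_natFam {S : Finset (Vertex n m)} {x : Finset ℕ} (hx : x ∈ natFam S) :
    #x = m := by
  obtain ⟨s, -, rfl⟩ := mem_natFam.mp hx
  rw [card_map, s.2]

theorem colexLT_map_val {s t : Finset (Fin n)} :
    ColexLT (s.map Fin.valEmbedding) (t.map Fin.valEmbedding) ↔ toColex s < toColex t := by
  rw [colexLT_iff, map_eq_image, map_eq_image]
  exact Colex.toColex_image_lt_toColex_image Fin.val_strictMono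

/-- The initial segments of the colex order in the Johnson graph are the families `casc m l`. -/
theorem natFam_colexInitSeg {l : List ℕ} (hl : Dec l) (hn : ∀ c ∈ l, c < n) :
    natFam (colexInitSeg n m (cas m l)) = casc m l := by
  set C : Finset (Vertex n m) := {s | s.1.map Fin.valEmbedding ∈ casc m l}
  have hC : natFam C = casc m l := by
    ext x
    rw [mem_natFam]
    constructor
    · rintro ⟨s, hs, rfl⟩
      exact (mem_filter.mp hs).2
    · intro hx
      have h1 := lt_of_mem_casc hl hn hx
      have h2 := map_finPart h1
      refine ⟨⟨finPart n x, (card_finPart h1).trans (card_of_mem_casc hl hx)⟩, ?_, h2⟩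
      simpa [C, h2] using hx
  have hcard : #C = cas m l := by rw [← card_natFam, hC, card_casc hl]
  rw [← hC]
  congr 1
  ext s
  rw [colexInitSeg, mem_filter]
  simp only [mem_univ, true_and]
  have hsize (t : Vertex n m) :
      #(s.1.map Fin.valEmbedding) = #(t.1.map Fin.valEmbedding) := by
    rw [card_map, card_map, s.2, t.2]
  constructor
  · intro h
    by_contra hs
    refine h.not_ge (hcard ▸ card_le_card fun t ht => mem_filter.mpr ⟨mem_univ t, ?_⟩)
    rw [← colexLT_map_val]
    have ht : t.1.map Fin.valEmbedding ∈ casc m l := by simpa [C] using ht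
    have hs : s.1.map Fin.valEmbedding ∉ casc m l := by simpa [C] using hs
    obtain h | h | h := colexLT_trichotomy (t.1.map Fin.valEmbedding) (s.1.map Fin.valEmbedding)
    · exact h
    · exact absurd (h ▸ ht) hs
    · exact absurd (downClosed_casc hl _ ht _ (hsize t) (by simp) h) hs
  · intro hs
    rw [← hcard]
    refine card_lt_card ⟨fun t ht => ?_, fun h => ?_⟩
    · have ht := colexLT_map_val.mpr (mem_filter.mp ht).2
      simp only [C, mem_filter, mem_univ, true_and] at hs ⊢
      exact downClosed_casc hl _ hs _ (hsize t).symm (by simp) ht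
    · exact lt_irrefl _ (mem_filter.mp (h hs)).2

end JohnsonIso.Cascade

namespace JohnsonIso.Cascade

open Finset
open scoped FinsetFamily

variable {n m k : ℕ}

/-! ### Automorphisms -/

/-- The automorphism of the Johnson graph given by a permutation of the points. -/
def permIso (m : ℕ) (τ : Equiv.Perm (Fin n)) : johnsonGraph n m ≃g johnsonGraph n m where
  toFun v := ⟨v.1.map τ.toEmbedding, (card_map _).trans v.2⟩
  invFun v := ⟨v.1.map τ.symm.toEmbedding, (card_map _).trans v.2⟩
  left_inv v := by
    ext a
    simp
  right_inv v := by
    ext a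
    simp
  map_rel_iff' {s t} := by
    change #(symmDiff (s.1.map τ.toEmbedding) (t.1.map τ.toEmbedding)) = 2 ↔ #(symmDiff s.1 t.1) = 2
    rw [map_eq_image, map_eq_image, ← image_symmDiff _ _ τ.toEmbedding.injective,
      card_image_of_injective _ τ.toEmbedding.injective]

theorem card_boundary_map {V : Type*} [Fintype V] {G : SimpleGraph V} (φ : G ≃g G)
    (S : Finset V) : #(boundary G (S.map φ.toEquiv.toEmbedding)) = #(boundary G S) := by
  refine (congrArg card ?_).trans (card_map φ.toEquiv.toEmbedding)
  ext y
  obtain ⟨x, rfl⟩ := φ.surjective y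
  have hmem (X : Finset V) (x : V) : φ x ∈ X.map φ.toEquiv.toEmbedding ↔ x ∈ X :=
    mem_map' φ.toEquiv.toEmbedding
  rw [hmem, mem_boundary, mem_boundary, hmem]
  refine and_congr_right fun _ => ⟨?_, ?_⟩
  · rintro ⟨z, hz, hzx⟩
    obtain ⟨w, hw, rfl⟩ := mem_map.mp hz
    exact ⟨w, hw, φ.map_adj_iff.mp hzx⟩
  · rintro ⟨w, hw, hwx⟩
    exact ⟨φ w, (hmem _ _).mpr hw, φ.map_adj_iff.mpr hwx⟩

/-- A permutation of `ℕ` mapping one family on `Fin n` to another gives an automorphism. -/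
theorem exists_iso_map_eq {S C : Finset (Vertex n m)} {σ : Equiv.Perm ℕ}
    (h : (natFam S).image (map σ.toEmbedding) = natFam C) :
    ∃ φ : johnsonGraph n m ≃g johnsonGraph n m, S.map φ.toEquiv.toEmbedding = C := by
  have hlt : ∀ v ∈ S, ∀ i ∈ v.1, σ i < n := by
    intro v hv i hi
    have h1 : (v.1.map Fin.valEmbedding).map σ.toEmbedding ∈ natFam C :=
      h ▸ mem_image_of_mem _ (mem_natFam.mpr ⟨v, hv, rfl⟩)
    obtain ⟨w, -, hw⟩ := mem_natFam.mp h1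
    have h2 : σ i ∈ w.1.map Fin.valEmbedding := by
      rw [hw, map_map]
      exact mem_map_of_mem (Fin.valEmbedding.trans σ.toEmbedding) hi
    obtain ⟨j, -, hj⟩ := mem_map.mp h2
    exact hj ▸ j.2
  -- The permutation `σ` need not preserve `range n`, but it maps the points used by `S` into it.
  -- This partial injection extends to a permutation of `Fin n`.
  obtain ⟨g, hg⟩ := exists_equiv_extend_of_card_eq (t := range n) (s := (finFam S).biUnion id)
    (f := fun i : Fin n => σ i) (by simp) (by
      intro y hy
      obtain ⟨i, hi, rfl⟩ := mem_image.mp hy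
      obtain ⟨x, hx, hix⟩ := mem_biUnion.mp hi
      obtain ⟨hx, hxS⟩ := mem_finFam.mp hx
      exact mem_range.mpr (hlt _ hxS i hix))
    ((σ.injective.comp Fin.val_injective).injOn)
  have hinj : Function.Injective fun i : Fin n => (⟨g i, mem_range.mp (g i).2⟩ : Fin n) := by
    intro i j hij
    exact g.injective (Subtype.ext (by simpa using hij))
  set τ := Equiv.ofBijective _ (Finite.injective_iff_bijective.mp hinj)
  refine ⟨permIso m τ, natFam_injective ?_⟩
  rw [← h]
  have key : ∀ v ∈ S, ((permIso m τ v).1).map Fin.valEmbedding =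
      (v.1.map Fin.valEmbedding).map σ.toEmbedding := by
    intro v hv
    change (v.1.map τ.toEmbedding).map _ = _
    rw [map_map, map_map, map_eq_image, map_eq_image]
    refine image_congr fun i hi => ?_
    exact hg i (mem_biUnion.mpr ⟨v.1, mem_finFam.mpr ⟨v.2, hv⟩, hi⟩)
  ext y
  simp only [mem_natFam, mem_image]
  constructor
  · rintro ⟨w, hw, rfl⟩
    obtain ⟨v, hv, rfl⟩ := mem_map.mp hw
    exact ⟨_, ⟨v, hv, rfl⟩, (key v hv).symm⟩
  · rintro ⟨_, ⟨v, hv, rfl⟩, rfl⟩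
    exact ⟨_, mem_map_of_mem _ hv, key v hv⟩

/-! ### The boundary of an initial segment -/

theorem mem_image_upShadow {F : Finset (Finset (Fin n))} {y : Finset ℕ} :
    y ∈ (∂⁺ F).image (map Fin.valEmbedding) ↔
      ∃ z ∈ F.image (map Fin.valEmbedding), ∃ j < n, j ∉ z ∧ insert j z = y := by
  simp only [mem_image, mem_upShadow_iff]
  constructor
  · rintro ⟨_, ⟨z, hz, j, hj, rfl⟩, rfl⟩
    exact ⟨_, ⟨z, hz, rfl⟩, j, j.2, by simpa [Fin.val_inj] using hj, by rw [map_insert]; rfl⟩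
  · rintro ⟨_, ⟨z, hz, rfl⟩, j, hj, hjz, rfl⟩
    refine ⟨_, ⟨z, hz, ⟨j, hj⟩, fun h => hjz ?_, rfl⟩, by rw [map_insert]; rfl⟩
    exact mem_map_of_mem Fin.valEmbedding h

theorem insert_injOn_of_lt {c : ℕ} {A : Finset (Finset ℕ)} {B : Finset ℕ}
    (hA : ∀ z ∈ A, ∀ e ∈ z, e < c) (hB : ∀ j ∈ B, c ≤ j) :
    Set.InjOn (fun q : Finset ℕ × ℕ => insert q.2 q.1) (A ×ˢ B : Finset (Finset ℕ × ℕ)) := by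
  rintro ⟨z, i⟩ h1 ⟨w, j⟩ h2 h
  obtain ⟨hz, hi⟩ := mem_product.mp (mem_coe.mp h1)
  obtain ⟨hw, hj⟩ := mem_product.mp (mem_coe.mp h2)
  dsimp only at hz hi hw hj h
  have hiz : i ∉ z := fun h => absurd (hA z hz i h) (hB i hi).not_gt
  have hiw : i ∉ w := fun h => absurd (hA w hw i h) (hB i hi).not_gt
  obtain rfl : i = j := by
    have h3 : i ∈ insert j w := h ▸ mem_insert_self i z
    exact (mem_insert.mp h3).resolve_right hiw
  have h3 := congrArg (fun s => s.erase i) h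
  simp only [erase_insert hiz, erase_insert hiw] at h3
  rw [h3]

/-- The sets of the upper shadow are sorted by their points from `c` on: none (`P`), exactly one
(`Q`), or `c` and one further point (`R`). -/
theorem card_upShadow_of_image_eq {F : Finset (Finset (Fin n))} {p c : ℕ} {l : List ℕ}
    (hF : F.image (map Fin.valEmbedding) = casc (p + 1) (c :: l)) (hl : Dec (c :: l)) (hc : c < n) :
    #(∂⁺ F) = c.choose (p + 2) + c.choose (p + 1) * (n - c) + cas p l * (n - (c + 1)) := by
  rw [← card_image_map Fin.valEmbedding]
  have hlt : ∀ z ∈ casc p l, ∀ e ∈ z, e < c := fun z hz => lt_of_mem_casc_tail hl hz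
  set P := powersetCard (p + 2) (range c)
  set Q := (powersetCard (p + 1) (range c) ×ˢ Ico c n).image fun q => insert q.2 q.1
  set R := ((casc p l).image (insert c) ×ˢ Ico (c + 1) n).image fun q => insert q.2 q.1
  have hrange : ∀ q, ∀ z ∈ powersetCard q (range c), ∀ e ∈ z, e < c := fun q z hz e he =>
    mem_range.mp ((mem_powersetCard.mp hz).1 he)
  have hins : ∀ z ∈ (casc p l).image (insert c), ∀ e ∈ z, e < c + 1 := by
    intro z hz e he
    obtain ⟨w, hw, rfl⟩ := mem_image.mp hz
    obtain rfl | he := mem_insert.mp he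
    · exact Nat.lt_succ_self _
    · exact (hlt w hw e he).trans (Nat.lt_succ_self _)
  have hP : #P = c.choose (p + 2) := by rw [card_powersetCard, card_range]
  have hQ : #Q = c.choose (p + 1) * (n - c) := by
    rw [card_image_of_injOn (insert_injOn_of_lt (hrange _) fun j hj => (mem_Ico.mp hj).1),
      card_product, card_powersetCard, card_range, Nat.card_Ico]
  have hR : #R = cas p l * (n - (c + 1)) := by
    rw [card_image_of_injOn (insert_injOn_of_lt hins fun j hj => (mem_Ico.mp hj).1),
      card_product, Nat.card_Ico, card_image_of_injOn, card_casc hl.of_cons]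
    intro x hx y hy hxy
    have h3 := congrArg (fun s => s.erase c) hxy
    simpa only [erase_insert (notMem_of_mem_casc_tail hl hx),
      erase_insert (notMem_of_mem_casc_tail hl hy)] using h3
  have hPQ : Disjoint P Q := by
    rw [disjoint_left]
    intro y hy hy'
    obtain ⟨⟨z, j⟩, hzj, rfl⟩ := mem_image.mp hy'
    have h1 := hrange _ _ hy j (mem_insert_self _ _)
    have h2 := (mem_Ico.mp (mem_product.mp hzj).2).1
    dsimp only at h2
    omega
  have hPQR : Disjoint (P ∪ Q) R := by
    rw [disjoint_right]
    intro y hy hy'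
    obtain ⟨⟨w, j⟩, hwj, rfl⟩ := mem_image.mp hy
    have hj := (mem_Ico.mp (mem_product.mp hwj).2).1
    obtain ⟨z, hz, hzw⟩ := mem_image.mp (mem_product.mp hwj).1
    dsimp only at hj hzw hy'
    subst hzw
    obtain hy' | hy' := mem_union.mp hy'
    · have := hrange _ _ hy' j (mem_insert_self _ _)
      omega
    · obtain ⟨⟨v, i⟩, hvi, h⟩ := mem_image.mp hy'
      have hv := hrange _ v (mem_product.mp hvi).1
      dsimp only at h
      have h1 : j ∈ insert i v := h ▸ mem_insert_self _ _
      have h2 : c ∈ insert i v := h ▸ mem_insert_of_mem (mem_insert_self _ _)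
      obtain rfl | h1 := mem_insert.mp h1
      · obtain rfl | h2 := mem_insert.mp h2
        · omega
        · exact lt_irrefl _ (hv c h2)
      · have := hv j h1
        omega
  rw [← hP, ← hQ, ← hR, ← card_union_of_disjoint hPQ, ← card_union_of_disjoint hPQR]
  congr 1
  ext y
  rw [mem_image_upShadow, hF, mem_union, mem_union]
  simp only [casc_succ_cons]
  constructor
  · rintro ⟨z, hz, j, hjn, hjz, rfl⟩
    obtain hz | hz := mem_union.mp hz
    · left
      by_cases hjc : j < c
      · left
        obtain ⟨h1, h2⟩ := mem_powersetCard.mp hz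
        refine mem_powersetCard.mpr ⟨insert_subset (mem_range.mpr hjc) h1, ?_⟩
        rw [card_insert_of_notMem hjz, h2]
      · right
        exact mem_image.mpr ⟨(z, j), mem_product.mpr ⟨hz, mem_Ico.mpr ⟨not_lt.mp hjc, hjn⟩⟩, rfl⟩
    · by_cases hjc : c < j
      · right
        exact mem_image.mpr ⟨(z, j), mem_product.mpr ⟨hz, mem_Ico.mpr ⟨hjc, hjn⟩⟩, rfl⟩
      -- Adding `j < c` to `insert c w` gives a subset of `range c` together with `c`, already
      -- counted in `Q`.
      · left; right
        obtain ⟨w, hw, rfl⟩ := mem_image.mp hz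
        have hjw : j ∉ w := fun h => hjz (mem_insert_of_mem h)
        have hjc : j < c := lt_of_le_of_ne (not_lt.mp hjc) fun h => hjz (h ▸ mem_insert_self _ _)
        refine mem_image.mpr ⟨(insert j w, c), mem_product.mpr ⟨mem_powersetCard.mpr
          ⟨insert_subset (mem_range.mpr hjc) fun e he => mem_range.mpr (hlt w hw e he), ?_⟩,
          mem_Ico.mpr ⟨le_rfl, hc⟩⟩, insert_comm _ _ _⟩
        rw [card_insert_of_notMem hjw, card_of_mem_casc hl.of_cons hw]
  · rintro ((hy | hy) | hy)
    · obtain ⟨h1, h2⟩ := mem_powersetCard.mp hy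
      obtain ⟨e, he⟩ := card_pos.mp (show 0 < #y by omega)
      refine ⟨y.erase e, mem_union_left _ (mem_powersetCard.mpr ⟨(erase_subset _ _).trans h1, ?_⟩),
        e, (mem_range.mp (h1 he)).trans hc, by simp, insert_erase he⟩
      rw [card_erase_of_mem he, h2]
      rfl
    · obtain ⟨⟨z, j⟩, hzj, rfl⟩ := mem_image.mp hy
      obtain ⟨hz, hj⟩ := mem_product.mp hzj
      have hj := mem_Ico.mp hj
      exact ⟨z, mem_union_left _ hz, j, hj.2, fun h => absurd (hrange _ z hz j h) hj.1.not_gt, rfl⟩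
    · obtain ⟨⟨z, j⟩, hzj, rfl⟩ := mem_image.mp hy
      obtain ⟨hz, hj⟩ := mem_product.mp hzj
      have hj := mem_Ico.mp hj
      exact ⟨z, mem_union_right _ hz, j, hj.2, fun h => absurd (hins z hz j h) hj.1.not_gt, rfl⟩

end JohnsonIso.Cascade

namespace JohnsonIso.Cascade

open Finset
open scoped FinsetFamily

variable {n m k : ℕ}

/-! ### The theorem -/

theorem fOfRep_eq_sum_range (n m r : ℕ) (a : ℕ → ℕ) :
    fOfRep n m r a = ((a 0).choose (m - 1) : ℤ) * ((n : ℤ) - a 0) +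
      ∑ i ∈ range r, (((a (i + 1)).choose (m - (i + 1) - 1) : ℤ) * ((n : ℤ) - a 0 - 1) -
        ((a (i + 1)).choose (m - (i + 1)) : ℤ)) := by
  rw [fOfRep, range_eq_Ico, sum_Ico_add' (fun i => ((a i).choose (m - i - 1) : ℤ) *
    ((n : ℤ) - a 0 - 1) - ((a i).choose (m - i) : ℤ)) 0 r 1]
  congr 2

/-- The shadow of the segment is `casc (m - 1)` of the same cascade, so its upper shadow is known.
Subtracting the `k` sets themselves cancels `C(a 0, m)` and leaves the negative terms of `f`. -/
theorem card_boundary_colexInitSeg {r : ℕ} {a : ℕ → ℕ} (h : IsBinomialRep m k r a)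
    (hr : r < m - 1) (hn : a 0 < n) :
    (#(boundary (johnsonGraph n m) (colexInitSeg n m k)) : ℤ) = f k n m := by
  have hl := dec_repList h.anti
  have hnd := nondeg_repList h.anti h.lt h.le
  have hk : k = cas m (repList r a) := by rw [cas_repList a h.lt.le, ← h.sum]
  obtain ⟨p, rfl⟩ : ∃ p, m = p + 2 := ⟨m - 2, by omega⟩
  obtain ⟨t, ht, h1, h2⟩ : ∃ t, repList r a = a 0 :: t ∧
      cas (p + 1) t = ∑ i ∈ range r, (a (i + 1)).choose (p + 2 - (i + 1)) ∧
      cas p t = ∑ i ∈ range r, (a (i + 1)).choose (p + 2 - (i + 1) - 1) := by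
    rcases r with _ | r
    · exact ⟨[], rfl, by simp, by simp⟩
    · refine ⟨_, rfl, ?_, ?_⟩
      · rw [cas_repList _ (by omega)]
        exact sum_congr rfl fun i _ => by congr 1; omega
      · rw [cas_repList _ (by omega)]
        exact sum_congr rfl fun i _ => by congr 1; omega
  rw [ht] at hl hnd hk
  have hlt : ∀ c ∈ a 0 :: t, c < n := by
    intro c hc
    obtain rfl | hc := List.mem_cons.mp hc
    · exact hn
    · exact ((List.pairwise_cons.mp hl).1 c hc).trans hn
  have hC := natFam_colexInitSeg (m := p + 2) hl hlt
  rw [← hk] at hC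
  have hcard := card_natFam (colexInitSeg n (p + 2) k)
  rw [hC, card_casc hl, ← hk] at hcard
  have hF : (∂ (finFam (colexInitSeg n (p + 2) k))).image (map Fin.valEmbedding) =
      casc (p + 1) (a 0 :: t) := by
    rw [← shadow_image_map]
    change ∂ (natFam _) = _
    rw [hC, shadow_casc hl hnd]
  have h3 := card_boundary_add_card (by omega) (colexInitSeg n (p + 2) k)
  rw [← hcard, card_upShadow_of_image_eq hF hl hn] at h3
  rw [cas_succ_cons, h1] at hk
  rw [h2] at h3
  rw [f_eq h, fOfRep_eq_sum_range, sum_sub_distrib, ← sum_mul]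
  zify [hn.le, show a 0 + 1 ≤ n by omega] at h3 hk
  simp only [show p + 2 - 1 = p + 1 by omega]
  rw [show p + 1 + 1 = p + 2 by omega] at hk
  linear_combination h3 - hk

/-- For large `n`, a set of `k` vertices is isomorphic to the initial segment, or it has a larger
boundary. -/
theorem exists_iso_or_card_boundary_lt {l : List ℕ} (hl : Dec l) (hnd : Nondeg m l)
    (hlen : l.length < m) (hlt : ∀ c ∈ l, c < n) (hn : m + (cas m l * m) ^ 2 ≤ n)
    {S : Finset (Vertex n m)} (hS : #S = cas m l) :
    (∃ φ : johnsonGraph n m ≃g johnsonGraph n m,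
      S.map φ.toEquiv.toEmbedding = colexInitSeg n m (cas m l)) ∨
    #(boundary (johnsonGraph n m) (colexInitSeg n m (cas m l))) <
      #(boundary (johnsonGraph n m) S) := by
  have hC := natFam_colexInitSeg (m := m) hl hlt
  have hcard := card_natFam (colexInitSeg n m (cas m l))
  rw [hC, card_casc hl] at hcard
  by_cases h : #(∂ (natFam S)) ≤ casShadow m l
  · left
    obtain ⟨σ, hσ⟩ := exists_perm_image_eq (fun x hx => card_of_mem_natFam hx) hl hnd hlen
      ((card_natFam S).trans hS) h
    exact exists_iso_map_eq (hσ.trans hC.symm)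
  · right
    refine card_boundary_lt (by omega) (hcard.symm.trans hS.symm) (by rwa [← hcard]) ?_
    rwa [← card_shadow_natFam, ← card_shadow_natFam, hC, card_shadow_casc hl hnd, ← not_le]

/-- The lower bound for sets whose size has a full cascade. -/
theorem le_card_boundary_of_full {a : ℕ → ℕ} (h : IsBinomialRep m k (m - 1) a)
    (hn : k * m * m + (k * m) ^ 2 + 2 * k ≤ n) {S : Finset (Vertex n m)} (hS : #S = k) :
    f (k - a (m - 1)) n m + a (m - 1) ≤ (#(boundary (johnsonGraph n m) S) : ℤ) := by
  have hm : 0 < m := by have := h.lt; omega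
  obtain ⟨p, rfl⟩ : ∃ p, m = p + 1 := ⟨m - 1, by omega⟩
  simp only [Nat.add_sub_cancel] at h ⊢
  have hsum := h.sum
  rw [sum_range_succ, show p + 1 - p = 1 by omega, Nat.choose_one_right] at hsum
  set s := ∑ i ∈ range p, (a i).choose (p - i) with hs
  have hshadow : s + 1 ≤ #(∂ (finFam S)) := by
    rw [← card_shadow_natFam]
    refine le_trans ?_ (casShadow_le_card_shadow (fun x hx => card_of_mem_natFam hx)
      (dec_repList h.anti) (nondeg_repList h.anti h.lt h.le) (l := repList p a) ?_)
    · rw [casShadow_succ, cas_repList _ le_rfl, sum_range_succ, Nat.sub_self, Nat.choose_zero_right]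
    · rw [card_natFam, hS, cas_repList _ h.lt.le, ← h.sum]
  have hle := card_shadow_le (F := finFam S) fun _ hx => card_of_mem_finFam hx
  rw [card_finFam, hS] at hle
  have hb := card_shadow_mul_le hm S
  rw [hS, Nat.add_sub_cancel] at hb
  have hf : f (k - a p) n (p + 1) ≤ s * n := by
    rcases p with _ | p
    -- Here `k - a 0 = 0` has no representation, and `f` takes its default value 0.
    · rw [f, dif_neg]
      · positivity
      · rintro ⟨⟨r, b⟩, hb⟩
        have h1 := hb.sum
        dsimp only at h1
        rw [sum_range_succ] at h1
        have h2 : 0 < (b r).choose (0 + 1 - r) := Nat.choose_pos hb.le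
        rw [range_zero, sum_empty, zero_add] at hsum
        omega
    · have h1 := h.anti p (by omega)
      have h2 := h.le
      rw [f_eq (r := p) (a := a) ⟨by omega, fun i hi => h.anti i (by omega), by omega, by omega⟩,
        fOfRep_eq_sum_range, hs, sum_range_succ', add_comm]
      push_cast
      rw [add_mul, sum_mul]
      refine add_le_add (sum_le_sum fun i _ => ?_) ?_
      · simp only [show p + 1 - i - 1 = p - i by omega]
        have : ((a (i + 1)).choose (p - i) : ℤ) * ((n : ℤ) - a 0 - 1) ≤
            ((a (i + 1)).choose (p - i) : ℤ) * n :=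
          mul_le_mul_of_nonneg_left (by omega) (by positivity)
        have : (0 : ℤ) ≤ ((a (i + 1)).choose (p + 1 - i) : ℤ) := by positivity
        linarith
      · exact mul_le_mul_of_nonneg_left (by omega) (by positivity)
  have h1 : (s + 1) * (n - p) ≤ #(boundary (johnsonGraph n (p + 1)) S) + k + (k * (p + 1)) ^ 2 :=
    (Nat.mul_le_mul_right _ hshadow).trans hb
  have h2 : (s + 1) * p ≤ k * (p + 1) * (p + 1) :=
    Nat.mul_le_mul (hshadow.trans hle) (Nat.le_succ p)
  have h3 : p ≤ n := by
    have : (s + 1) * p ≤ n := by omega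
    exact (Nat.le_mul_of_pos_left p (Nat.succ_pos s)).trans this
  have h4 : s * n + n ≤ (s + 1) * (n - p) + (s + 1) * p := by
    rw [← mul_add, Nat.sub_add_cancel h3]
    exact (Nat.succ_mul s n).ge
  have h5 : s * n + a p ≤ #(boundary (johnsonGraph n (p + 1)) S) := by omega
  have h6 : ((s * n + a p : ℕ) : ℤ) ≤ #(boundary (johnsonGraph n (p + 1)) S) := by
    exact_mod_cast h5
  push_cast at h6
  linarith

theorem card_colexInitSeg {r : ℕ} {a : ℕ → ℕ} (h : IsBinomialRep m k r a) (hn : a 0 < n) :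
    #(colexInitSeg n m k) = k ∧ ∀ c ∈ repList r a, c < n := by
  have hl := dec_repList h.anti
  have hlt : ∀ c ∈ repList r a, c < n := by
    intro c hc
    rcases r with _ | r
    · rw [repList, List.mem_singleton] at hc
      omega
    · obtain rfl | hc := List.mem_cons.mp hc
      · exact hn
      · exact ((List.pairwise_cons.mp hl).1 c hc).trans hn
  refine ⟨?_, hlt⟩
  have hk : k = cas m (repList r a) := by rw [cas_repList a h.lt.le, ← h.sum]
  rw [← card_natFam, hk, natFam_colexInitSeg hl hlt, card_casc hl]

end JohnsonIso.Cascade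

/-! ### The two cases together -/

open JohnsonIso.Cascade in
theorem mainTheorem1 (k m : ℕ) (hk : 0 < k) (hm : 0 < m) :
    ∃ N : ℕ, ∀ n ≥ N, ∀ (r : ℕ) (a : ℕ → ℕ), JohnsonIso.IsBinomialRep m k r a →
      (r < m - 1 →
        (JohnsonIso.mu n m k : ℤ) = JohnsonIso.f k n m ∧
        (JohnsonIso.colexInitSeg n m k).card = k ∧
        JohnsonIso.IsOptimal (JohnsonIso.johnsonGraph n m) (JohnsonIso.colexInitSeg n m k) ∧
        ∀ S : Finset (JohnsonIso.Vertex n m), S.card = k →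
          JohnsonIso.IsOptimal (JohnsonIso.johnsonGraph n m) S →
          ∃ φ : JohnsonIso.johnsonGraph n m ≃g JohnsonIso.johnsonGraph n m,
            (φ : JohnsonIso.Vertex n m → JohnsonIso.Vertex n m) '' S =
              JohnsonIso.colexInitSeg n m k) ∧
      (r = m - 1 →
        JohnsonIso.f (k - a r) n m + (a r : ℤ) ≤ (JohnsonIso.mu n m k : ℤ)) := by
  obtain ⟨r₀, a₀, h₀⟩ := JohnsonIso.exists_isBinomialRep hm hk
  -- `a₀ 0 + 1` lets the initial segment fit into `n` points; the other terms dominate the errors in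
  -- both cases. The bound can be fixed before `a` is given because representations are unique.
  refine ⟨a₀ 0 + 1 + (m + (k * m * m + (k * m) ^ 2 + 2 * k)), fun n hn r a h => ?_⟩
  have ha : a 0 < n := by
    rw [(h.unique h₀).2 0 (Nat.zero_le r)]
    omega
  obtain ⟨hcard, hlt⟩ := card_colexInitSeg h ha
  refine ⟨fun hr => ?_, ?_⟩
  · have hk' : JohnsonIso.Cascade.cas m (repList r a) = k := by
      rw [cas_repList a h.lt.le, ← h.sum]
    have key : ∀ S : Finset (JohnsonIso.Vertex n m), S.card = k → _ := fun S hS =>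
      exists_iso_or_card_boundary_lt (dec_repList h.anti) (nondeg_repList h.anti h.lt h.le)
        (by rw [length_repList]; omega) hlt (by rw [hk']; omega) (S := S) (hS.trans hk'.symm)
    rw [hk'] at key
    have hmu : JohnsonIso.mu n m k =
        (JohnsonIso.boundary (JohnsonIso.johnsonGraph n m) (JohnsonIso.colexInitSeg n m k)).card := by
      refine IsLeast.csInf_eq ⟨⟨_, hcard, rfl⟩, ?_⟩
      rintro b ⟨S, hS, rfl⟩
      obtain ⟨φ, hφ⟩ | h := key S hS
      · rw [← hφ, card_boundary_map]
      · exact h.le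
    refine ⟨by rw [hmu, card_boundary_colexInitSeg h hr ha], hcard, ?_, fun S hS hopt => ?_⟩
    · rw [JohnsonIso.IsOptimal, hcard, ← hmu, JohnsonIso.mu]
    · obtain ⟨φ, hφ⟩ | h := key S hS
      · refine ⟨φ, ?_⟩
        rw [← hφ, Finset.coe_map]
        rfl
      · rw [JohnsonIso.IsOptimal, hS] at hopt
        rw [← hmu, JohnsonIso.mu, hopt] at h
        exact absurd h (lt_irrefl _)
  · rintro rfl
    -- The initial segment has `k` elements, so the infimum is attained and is not the default value
    -- of an empty set.
    obtain ⟨S, hS, hb⟩ := Nat.sInf_mem (s := {b : ℕ | ∃ X : Finset (JohnsonIso.Vertex n m),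
      X.card = k ∧ (JohnsonIso.boundary (JohnsonIso.johnsonGraph n m) X).card = b})
      ⟨_, _, hcard, rfl⟩
    rw [JohnsonIso.mu, JohnsonIso.isoFun, ← hb]
    exact le_card_boundary_of_full h (by omega) hS
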